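/- **Theorem 1.** Write $(a;b)_\infty=\prod_{k\ge 0}(1-ab^k)$ and $(a)_\infty=(a;q)_\infty$. The rank of a partition is its largest part minus its number of parts. The crank of a partition with exactly $\omega$ parts equal to $1$ is its largest part if $\omega=0$, and the number of parts larger than $\omega$, minus $\omega$, if $\omega>0$. Let $N(m,n)$ be the number of partitions of $n$ with rank $m$. For $n\neq 1$ let $M(m,n)$ be the number of partitions of $n$ with crank $m$, and for $n=1$ put, as usual, $M(0,1)=-1$, $M(1,1)=M(-1,1)=1$ and $M(m,1)=0$ for all other $m$. Let $N_2(n)=\sum_{m\in\mathbb Z}m^2N(m,n)$ and $M_2(n)=\sum_{m\in\mathbb Z}m^2M(m,n)$. Then the following identities hold between formal power series in $q$ with rational coefficients, where all infinite sums and products converge coefficientwise: $$\sum_{n\ge1}\frac{q^n(q^{2n+1};q^2)_{\infty}}{(1-q^n)^2(q^{n+1})_{\infty}}=\frac{1}{(q^2;q^2)_{\infty}}\sum_{n\ge1}\frac{nq^n}{1-q^n}-\frac{1}{2}\sum_{n\ge1}N_2(n)q^{2n},$$ $$\sum_{n\ge1}\frac{q^{n(n+1)/2}(q^{2n+1};q^2)_{\infty}}{(1-q^n)^2(q^{n+1})_{\infty}}=\frac{1}{(q^2;q^2)_{\infty}}\sum_{n\ge1}\frac{nq^n}{1-q^n}-\frac{1}{2}\sum_{n\ge1}M_2(n)q^{2n}.$$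 -/

import Mathlib

open PowerSeries
open scoped PowerSeries.WithPiTopology

/-- The infinite `q`-shifted factorial `(a; b)_∞ = ∏_{k ≥ 0} (1 - a b^k)` in `ℚ⟦X⟧`, where the
infinite product is taken coefficientwise. -/
noncomputable def qPochInf (a b : ℚ⟦X⟧) : ℚ⟦X⟧ := ∏' k : ℕ, (1 - a * b ^ k)

/-- The product defining `(a; b)_∞` converges whenever `b` has zero constant term. -/
theorem qPochInf_multipliable (a b : ℚ⟦X⟧) (hb : constantCoeff b = 0) :
    Multipliable (fun k : ℕ => 1 - a * b ^ k) := by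
  have h : Multipliable (fun k : ℕ => 1 + (-(a * b ^ k))) := by
    apply WithPiTopology.multipliable_one_add_of_tendsto_order_atTop_nhds_top
    rw [ENat.tendsto_nhds_top_iff_natCast_lt]
    intro m
    filter_upwards [Filter.eventually_gt_atTop m] with k hk
    have h1 : ((k : ℕ) : ℕ∞) ≤ (b ^ k).order := by
      apply nat_le_order
      intro i hi
      exact coeff_of_lt_order i (lt_of_lt_of_le (by exact_mod_cast hi)
        (le_order_pow_of_constantCoeff_eq_zero k hb))
    rw [order_neg]
    calc (m : ℕ∞) < k := by exact_mod_cast hk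
      _ ≤ (b ^ k).order := h1
      _ ≤ a.order + (b ^ k).order := le_add_self
      _ ≤ (a * b ^ k).order := le_order_mul _ _
  simpa [sub_eq_add_neg] using h

namespace Nat.Partition

/-- The largest part of a partition (`0` for the empty partition). -/
def largestPart {n : ℕ} (p : n.Partition) : ℕ := p.parts.sup

/-- Dyson's rank: the largest part minus the number of parts. -/
def rank {n : ℕ} (p : n.Partition) : ℤ := (p.largestPart : ℤ) - (p.parts.card : ℤ)

/-- The Andrews–Garvan crank: if `ω` is the number of ones in `p`, the crank is the largest part
when `ω = 0`, and the number of parts larger than `ω` minus `ω` when `ω > 0`. -/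
def crank {n : ℕ} (p : n.Partition) : ℤ :=
  if p.parts.count 1 = 0 then (p.largestPart : ℤ)
  else ((p.parts.filter (fun k => p.parts.count 1 < k)).card : ℤ) - (p.parts.count 1 : ℤ)

end Nat.Partition

/-- `N(m, n)`: the number of partitions of `n` with rank `m`. -/
def rankCount (m : ℤ) (n : ℕ) : ℤ :=
  ((Finset.univ.filter (fun p : n.Partition => p.rank = m)).card : ℤ)

/-- `M(m, n)`: the number of partitions of `n` with crank `m`, with the standard convention
`M(0, 1) = -1`, `M(1, 1) = M(-1, 1) = 1` and `M(m, 1) = 0` otherwise, for `n = 1`. -/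
def crankCount (m : ℤ) (n : ℕ) : ℤ :=
  if n = 1 then (if m = 0 then -1 else if m = 1 ∨ m = -1 then 1 else 0)
  else ((Finset.univ.filter (fun p : n.Partition => p.crank = m)).card : ℤ)

/-- Only finitely many `m` contribute to the moments of the rank. -/
theorem rankCount_support_finite (n : ℕ) :
    (Function.support fun m : ℤ => m ^ 2 * rankCount m n).Finite := by
  refine (Finset.univ.image (fun p : n.Partition => p.rank)).finite_toSet.subset ?_
  intro m hm
  by_contra h
  apply hm
  have : (Finset.univ.filter (fun p : n.Partition => p.rank = m)) = ∅ := by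
    ext p; simp at h ⊢; exact h p
  simp [rankCount, this]

/-- Only finitely many `m` contribute to the moments of the crank. -/
theorem crankCount_support_finite (n : ℕ) :
    (Function.support fun m : ℤ => m ^ 2 * crankCount m n).Finite := by
  by_cases hn : n = 1
  · refine ({1, -1} : Finset ℤ).finite_toSet.subset ?_
    intro m hm
    by_contra h
    apply hm
    have h' : ¬ (m = 1 ∨ m = -1) := by simpa using h
    by_cases h0 : m = 0 <;> simp [crankCount, hn, h0, h']
  · refine (Finset.univ.image (fun p : n.Partition => p.crank)).finite_toSet.subset ?_
    intro m hm
    by_contra h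
    apply hm
    have : (Finset.univ.filter (fun p : n.Partition => p.crank = m)) = ∅ := by
      ext p; simp at h ⊢; exact h p
    simp [crankCount, hn, this]

/-- The second rank moment `N₂(n) = ∑_{m ∈ ℤ} m² N(m, n)`; the sum has finite support. -/
noncomputable def rankMoment2 (n : ℕ) : ℤ := ∑ᶠ m : ℤ, m ^ 2 * rankCount m n

/-- The second crank moment `M₂(n) = ∑_{m ∈ ℤ} m² M(m, n)`; the sum has finite support. -/
noncomputable def crankMoment2 (n : ℕ) : ℤ := ∑ᶠ m : ℤ, m ^ 2 * crankCount m n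

/-! Write (q)_n for (q;q)_n. Since (q)_∞ = (q;q²)_∞ (q²;q²)_∞, each left summand equals q^n
(q)_{n-1}² β_n / (q²;q²)_∞, with β_n = 1/((q)_n (q;q²)_n) in the first identity and q^{n(n-1)/2}
times this in the second (`summand_eq`). Both β belong to Bailey pairs relative to 1 whose α is
supported on even indices (`isBaileyPair_rankAlpha`, `isBaileyPair_crankAlpha`). The Bailey lemma
with both parameters tending to 1 (`IsBaileyPair.tsum_qFac_sq`) turns Σ q^n (q)_{n-1}² β_n into Σ
q^n/(1-q^n)² + Σ_{r≥1} α_{2r} q^{2r}/(1-q^{2r})². The first sum is Σ n q^n/(1-q^n) (`tsum_lambert`);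
the second has to be recognised as a moment series at q².

With z = 1/y, the rank and crank generating functions are Σ q^{k²}/((yq;q)_k (zq;q)_k) and
(q)_∞/((yq;q)_∞ (zq;q)_∞). Second moments are extracted without differentiation: y = (1+ε)(1+δ) in
ℚ[ε,δ]/(ε²,δ²), where the εδ-coefficient of y^a z^b is (a-b)² and y+z-2 has square zero, so the
products linearise. Hence Σ N₂(n)q^n = 2 Σ_k q^{k²}/(q)_k² Σ_{j≤k} q^j/(1-q^j)² and Σ M₂(n)q^n =
2/(q)_∞ Σ q^j/(1-q^j)².

The unit Bailey pair closes the argument. In the same lemma it makes Σ q^j/(1-q^j)² an alternating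
series (`lambertSeries_eq`); in the finite form of that lemma it yields a Bailey pair with β_n =
(Σ_{j≤n} q^j/(1-q^j)²)/(q)_n² (`isBaileyPair_lambertAlpha`), to which Σ q^{n²}β_n = (q)_∞⁻¹ Σ
q^{r²}α_r applies. After q ↦ q² both series have exactly the terms α_{2r} q^{2r}/(1-q^{2r})², with
the opposite sign. -/

/-! ### Finite Bailey pairs relative to `1` -/

section Bailey

open Finset

variable {A : Type*} [CommRing A]

/-- The `q`-factorial `(q; q)_n`. -/
def qFac (q : A) (n : ℕ) : A := ∏ i ∈ range n, (1 - q ^ (i + 1))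

/-- The product `u 0 ⋯ u (n - 1)`; it is `1 / (q; q)_n` when `u k` is inverse to `1 - q ^ (k + 1)`. -/
def invFac (u : ℕ → A) (n : ℕ) : A := ∏ i ∈ range n, u i

/-- `1 / (q; q)_{n - k}`, with the convention that it vanishes for `n < k`. -/
def invFacSub (u : ℕ → A) (n k : ℕ) : A := if k ≤ n then invFac u (n - k) else 0

/-- `(α, β)` is a Bailey pair relative to `1`. -/
def IsBaileyPair (u α β : ℕ → A) : Prop :=
  ∀ n, β n = ∑ r ∈ range (n + 1), α r * (invFacSub u n r * invFac u (n + r))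

theorem qFac_succ (q : A) (n : ℕ) : qFac q (n + 1) = qFac q n * (1 - q ^ (n + 1)) :=
  prod_range_succ _ _

theorem invFac_succ (u : ℕ → A) (n : ℕ) : invFac u (n + 1) = invFac u n * u n :=
  prod_range_succ _ _

@[simp] theorem invFac_zero (u : ℕ → A) : invFac u 0 = 1 := by simp [invFac]

@[simp] theorem qFac_zero (q : A) : qFac q 0 = 1 := by simp [qFac]

@[simp] theorem invFacSub_zero (u : ℕ → A) (n : ℕ) : invFacSub u n 0 = invFac u n := by
  simp [invFacSub]

theorem invFacSub_add (u : ℕ → A) (m k : ℕ) : invFacSub u (m + k) k = invFac u m := by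
  simp [invFacSub]

theorem invFacSub_of_lt (u : ℕ → A) {n k : ℕ} (h : n < k) : invFacSub u n k = 0 := by
  simp [invFacSub, h]

theorem invFacSub_succ_succ (u : ℕ → A) (n k : ℕ) :
    invFacSub u (n + 1) (k + 1) = invFacSub u n k := by
  simp [invFacSub]

variable {q : A} {u : ℕ → A}

theorem invFac_eq (hu : ∀ k, (1 - q ^ (k + 1)) * u k = 1) (n : ℕ) :
    invFac u n = (1 - q ^ (n + 1)) * invFac u (n + 1) := by
  rw [invFac_succ]; linear_combination -(invFac u n) * hu n

theorem qFac_mul_invFac (hu : ∀ k, (1 - q ^ (k + 1)) * u k = 1) (n : ℕ) :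
    qFac q n * invFac u n = 1 := by
  induction n with
  | zero => simp
  | succ n ih => rw [qFac_succ, invFac_succ]; linear_combination ih + qFac q n * invFac u n * hu n

theorem invFacSub_succ (hu : ∀ k, (1 - q ^ (k + 1)) * u k = 1) (m k : ℕ) :
    invFacSub u (m + k) (k + 1) = (1 - q ^ m) * invFac u m := by
  cases m with
  | zero => simp [invFacSub]
  | succ m =>
    rw [show m + 1 + k = m + (k + 1) by ring, invFacSub_add, invFac_eq hu]

/-- With `N = m + r` and common factors removed, this is (1-q^{N+1})² - (1-q^m)(1-q^{N+r+2}) = q^m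
(1-q^{r+1})². -/
theorem qFac_sq_mul_sub (hu : ∀ k, (1 - q ^ (k + 1)) * u k = 1) {N r : ℕ} (h : r ≤ N) :
    q ^ (r + 1) * u r ^ 2 * (qFac q (N + 1) ^ 2 *
        (invFacSub u (N + 1) (r + 1) * invFac u (N + 1 + (r + 1)))) =
      q ^ (r + 1) * u r ^ 2 * (qFac q N ^ 2 * (invFacSub u N (r + 1) * invFac u (N + (r + 1)))) +
      q ^ (N + 1) * qFac q N ^ 2 * (invFacSub u (N + 1) (r + 1) * invFac u (N + 1 + (r + 1))) := by
  obtain ⟨m, rfl⟩ := Nat.exists_eq_add_of_le' h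
  rw [invFacSub_succ hu, invFacSub_succ_succ, invFacSub_add, qFac_succ,
    show m + r + 1 + (r + 1) = (m + r + (r + 1)) + 1 by ring, invFac_eq hu (m + r + (r + 1))]
  have h1 : (1 - q ^ (r + 1)) ^ 2 * u r ^ 2 = 1 := by rw [← mul_pow, hu, one_pow]
  linear_combination (q ^ (m + r + 1)) * qFac q (m + r) ^ 2 * invFac u m *
    invFac u (m + r + (r + 1) + 1) * h1

/-- Finite form of the Bailey lemma with both parameters tending to 1. In the step from `N` to `N +
1`, the growth of the weights on the right reproduces the Bailey relation for `β (N + 1)`. -/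
theorem IsBaileyPair.sum_range_qFac_sq (hu : ∀ k, (1 - q ^ (k + 1)) * u k = 1) {α β : ℕ → A}
    (h : IsBaileyPair u α β) (N : ℕ) :
    ∑ n ∈ range N, q ^ (n + 1) * qFac q n ^ 2 * β (n + 1) =
      α 0 * ∑ k ∈ range N, q ^ (k + 1) * u k ^ 2 +
      ∑ r ∈ range N, α (r + 1) * (q ^ (r + 1) * u r ^ 2 *
        (qFac q N ^ 2 * (invFacSub u N (r + 1) * invFac u (N + (r + 1))))) := by
  induction N with
  | zero => simp
  | succ N ih =>
    have h0 : qFac q N ^ 2 * (invFac u (N + 1) * invFac u (N + 1)) = u N ^ 2 := by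
      rw [invFac_succ]
      linear_combination (u N ^ 2 * (qFac q N * invFac u N + 1)) * qFac_mul_invFac hu N
    have h1 : ∑ r ∈ range (N + 1), α (r + 1) * (q ^ (r + 1) * u r ^ 2 *
        (qFac q (N + 1) ^ 2 * (invFacSub u (N + 1) (r + 1) * invFac u (N + 1 + (r + 1))))) =
        ∑ r ∈ range (N + 1), α (r + 1) * (q ^ (r + 1) * u r ^ 2 *
          (qFac q N ^ 2 * (invFacSub u N (r + 1) * invFac u (N + (r + 1))))) +
        q ^ (N + 1) * qFac q N ^ 2 * ∑ r ∈ range (N + 1),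
          α (r + 1) * (invFacSub u (N + 1) (r + 1) * invFac u (N + 1 + (r + 1))) := by
      rw [mul_sum, ← sum_add_distrib]
      refine sum_congr rfl fun r hr => ?_
      linear_combination α (r + 1) * qFac_sq_mul_sub hu (Nat.lt_succ_iff.mp (mem_range.mp hr))
    -- The sum weighted at level `N` may include `r = N`, because `invFacSub u N (N + 1)` vanishes.
    rw [h1, sum_range_succ (fun n => q ^ (n + 1) * qFac q n ^ 2 * β (n + 1)), ih, h (N + 1),
      sum_range_succ' _ (N + 1), sum_range_succ (fun r => α (r + 1) * (q ^ (r + 1) * u r ^ 2 *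
        (qFac q N ^ 2 * (invFacSub u N (r + 1) * invFac u (N + (r + 1)))))) N,
      invFacSub_of_lt u (Nat.lt_succ_self N), sum_range_succ (fun k => q ^ (k + 1) * u k ^ 2) N,
      invFacSub_zero, add_zero]
    linear_combination α 0 * q ^ (N + 1) * h0

/-! ### The unit Bailey pair -/

/-- The coefficients `α` of the unit Bailey pair. -/
def unitAlpha (q : A) : ℕ → A
  | 0 => 1
  | r + 1 => (-1) ^ (r + 1) * q ^ ((r + 1) * r / 2) * (1 + q ^ (r + 1))

theorem tri_succ (s : ℕ) : (s + 2) * (s + 1) / 2 = (s + 1) * s / 2 + (s + 1) := by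
  rw [show (s + 2) * (s + 1) = (s + 1) * s + (s + 1) * 2 by ring, Nat.add_mul_div_right _ _ two_pos]

/-- The partial sums telescope to a closed form. At `R = n + 1` the boundary term vanishes and what
remains cancels the `r = 0` term of the Bailey relation. -/
theorem sum_unitAlpha (hu : ∀ k, (1 - q ^ (k + 1)) * u k = 1) (n R : ℕ) (hR : R ≤ n + 1) :
    ∑ r ∈ range R, unitAlpha q (r + 1) *
        (invFacSub u (n + 1) (r + 1) * invFac u (n + 1 + (r + 1))) =
      u n * (-(invFac u n * invFac u (n + 1)) +
        (-1) ^ R * q ^ ((R + 1) * R / 2) * (invFacSub u n R * invFac u (n + 1 + R))) := by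
  induction R with
  | zero => simp
  | succ R ih =>
    rw [sum_range_succ, ih (by omega)]
    obtain ⟨m, rfl⟩ := Nat.exists_eq_add_of_le' (Nat.le_of_succ_le_succ hR)
    rw [invFacSub_succ_succ, invFacSub_add, invFacSub_succ hu,
      show m + R + 1 + (R + 1) = (m + R + 1 + R) + 1 by ring, invFac_eq hu (m + R + 1 + R),
      unitAlpha, tri_succ R]
    have h := hu (m + R)
    linear_combination (-1) ^ R * q ^ ((R + 1) * R / 2) * (1 + q ^ (R + 1)) * invFac u m *
      invFac u (m + R + 1 + R + 1) * h

theorem isBaileyPair_unit (hu : ∀ k, (1 - q ^ (k + 1)) * u k = 1) :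
    IsBaileyPair u (unitAlpha q) (fun n => if n = 0 then 1 else 0) := by
  intro n
  cases n with
  | zero => simp [unitAlpha]
  | succ n =>
    rw [sum_range_succ', sum_unitAlpha hu n (n + 1) le_rfl,
      invFacSub_of_lt u (Nat.lt_succ_self n), invFacSub_zero, unitAlpha, add_zero, invFac_succ]
    simp; ring

/-! ### Bailey pairs supported on even indices -/

theorem sum_range_two_mul (f : ℕ → A) (n : ℕ) :
    ∑ k ∈ range (2 * n), f k = ∑ r ∈ range n, (f (2 * r) + f (2 * r + 1)) := by
  induction n with
  | zero => simp
  | succ n ih => rw [mul_add, sum_range_succ, sum_range_succ, ih, sum_range_succ]; ring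

/-- The sequence supported on even indices with `2 * r ↦ a r`. -/
def evenSeq (a : ℕ → A) (k : ℕ) : A := if Even k then a (k / 2) else 0

@[simp] theorem evenSeq_two_mul (a : ℕ → A) (r : ℕ) : evenSeq a (2 * r) = a r := by simp [evenSeq]

@[simp] theorem evenSeq_two_mul_add_one (a : ℕ → A) (r : ℕ) : evenSeq a (2 * r + 1) = 0 := by
  simp [evenSeq]

/-- The slack in `M` lets the sums at `n` and `n + 1` share one range of summation. -/
theorem sum_range_evenSeq (a : ℕ → A) (n M : ℕ) (hM : n ≤ M) :
    ∑ r ∈ range (n + 1), evenSeq a r * (invFacSub u n r * invFac u (n + r)) =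
      ∑ r ∈ range (M + 1), a r * (invFacSub u n (2 * r) * invFac u (n + 2 * r)) := by
  rw [show ∑ r ∈ range (M + 1), a r * (invFacSub u n (2 * r) * invFac u (n + 2 * r)) =
    ∑ k ∈ range (2 * (M + 1)), evenSeq a k * (invFacSub u n k * invFac u (n + k)) by
      rw [sum_range_two_mul]; simp]
  refine sum_subset (range_subset_range.mpr (by omega)) fun k _ hk => ?_
  rw [invFacSub_of_lt u (by simpa using hk)]; ring

/-- The even coefficients of the Bailey pair with `β n = 1 / ((q; q)_n (q; q²)_n)`. -/
def rankAlpha (q : A) : ℕ → A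
  | 0 => 1
  | s + 1 => (-1) ^ (s + 1) * q ^ ((s + 1) * (3 * s + 2)) * (1 + q ^ (2 * s + 2))

/-- The even coefficients of the Bailey pair with `β n = q ^ (n (n - 1) / 2) / ((q; q)_n (q; q²)_n)`. -/
def crankAlpha (q : A) : ℕ → A
  | 0 => 1
  | s + 1 => (-1) ^ (s + 1) * q ^ ((s + 1) * s) * (1 + q ^ (2 * s + 2))

/-- A creative-telescoping certificate: the recurrence in `n` expected of β, applied to a single
summand, is a difference of consecutive values in `s`. `rankAlpha_step` plays the same role for the
other pair. -/
theorem crankAlpha_step (hu : ∀ k, (1 - q ^ (k + 1)) * u k = 1) (n s : ℕ) :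
    (1 - q ^ (n + 1)) * (1 - q ^ (2 * n + 1)) * (crankAlpha q (s + 1) *
        (invFacSub u (n + 1) (2 * (s + 1)) * invFac u (n + 1 + 2 * (s + 1)))) -
      q ^ n * (crankAlpha q (s + 1) *
        (invFacSub u n (2 * (s + 1)) * invFac u (n + 2 * (s + 1)))) =
    (-1) ^ (s + 1) * q ^ ((s + 1) * s) *
        (invFacSub u (n + 1) (2 * (s + 1)) * invFac u (n + 2 * s + 1)) -
      (-1) ^ (s + 2) * q ^ ((s + 2) * (s + 1)) *
        (invFacSub u (n + 1) (2 * (s + 2)) * invFac u (n + 2 * (s + 1) + 1)) := by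
  rcases lt_or_ge (n + 1) (2 * (s + 1)) with h | h
  · simp [invFacSub_of_lt u h, invFacSub_of_lt u (show n < 2 * (s + 1) by omega),
      invFacSub_of_lt u (show n + 1 < 2 * (s + 2) by omega)]
  obtain ⟨m, hm⟩ := Nat.exists_eq_add_of_le' h
  obtain rfl : n = m + 2 * s + 1 := by omega
  have e0 : invFacSub u (m + 2 * s + 1 + 1) (2 * (s + 1)) = invFac u m := by
    rw [hm, invFacSub_add]
  have e1 : invFacSub u (m + 2 * s + 1) (2 * (s + 1)) = (1 - q ^ m) * invFac u m := by
    rw [show m + 2 * s + 1 = m + (2 * s + 1) by ring, show 2 * (s + 1) = 2 * s + 1 + 1 by ring,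
      invFacSub_succ hu]
  rw [e0, e1, show m + 2 * s + 1 + 2 * s + 1 = m + 4 * s + 2 by ring,
    show m + 2 * s + 1 + 2 * (s + 1) = m + 4 * s + 2 + 1 by ring,
    show m + 2 * s + 1 + 1 + 2 * (s + 1) = m + 4 * s + 2 + 1 + 1 by ring,
    invFac_eq hu (m + 4 * s + 2), invFac_eq hu (m + 4 * s + 2 + 1), crankAlpha]
  -- For `m = 0` the last boundary term is zero; its formula through `invFacSub_succ` needs `m ≥ 1`.
  cases m with
  | zero =>
    rw [invFacSub_of_lt u (by omega)]
    ring
  | succ m =>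
    have e2 : invFacSub u (m + 1 + 2 * s + 1 + 1) (2 * (s + 2)) =
        (1 - q ^ m) * ((1 - q ^ (m + 1)) * invFac u (m + 1)) := by
      rw [show m + 1 + 2 * s + 1 + 1 = m + (2 * s + 3) by ring,
        show 2 * (s + 2) = 2 * s + 3 + 1 by ring, invFacSub_succ hu, invFac_eq hu m]
    rw [e2]
    ring

theorem rankAlpha_step (hu : ∀ k, (1 - q ^ (k + 1)) * u k = 1) (n s : ℕ) :
    (1 - q ^ (n + 1)) * (1 - q ^ (2 * n + 1)) * (rankAlpha q (s + 1) *
        (invFacSub u (n + 1) (2 * (s + 1)) * invFac u (n + 1 + 2 * (s + 1)))) -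
      rankAlpha q (s + 1) * (invFacSub u n (2 * (s + 1)) * invFac u (n + 2 * (s + 1))) =
    (-1) ^ (s + 1) * q ^ (3 * (s + 1) * s + n + 1) *
        (invFacSub u (n + 1) (2 * (s + 1)) * invFac u (n + 2 * s + 1)) -
      (-1) ^ (s + 2) * q ^ (3 * (s + 2) * (s + 1) + n + 1) *
        (invFacSub u (n + 1) (2 * (s + 2)) * invFac u (n + 2 * (s + 1) + 1)) := by
  rcases lt_or_ge (n + 1) (2 * (s + 1)) with h | h
  · simp [invFacSub_of_lt u h, invFacSub_of_lt u (show n < 2 * (s + 1) by omega),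
      invFacSub_of_lt u (show n + 1 < 2 * (s + 2) by omega)]
  obtain ⟨m, hm⟩ := Nat.exists_eq_add_of_le' h
  obtain rfl : n = m + 2 * s + 1 := by omega
  have e0 : invFacSub u (m + 2 * s + 1 + 1) (2 * (s + 1)) = invFac u m := by
    rw [hm, invFacSub_add]
  have e1 : invFacSub u (m + 2 * s + 1) (2 * (s + 1)) = (1 - q ^ m) * invFac u m := by
    rw [show m + 2 * s + 1 = m + (2 * s + 1) by ring, show 2 * (s + 1) = 2 * s + 1 + 1 by ring,
      invFacSub_succ hu]
  rw [e0, e1, show m + 2 * s + 1 + 2 * s + 1 = m + 4 * s + 2 by ring,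
    show m + 2 * s + 1 + 2 * (s + 1) = m + 4 * s + 2 + 1 by ring,
    show m + 2 * s + 1 + 1 + 2 * (s + 1) = m + 4 * s + 2 + 1 + 1 by ring,
    invFac_eq hu (m + 4 * s + 2), invFac_eq hu (m + 4 * s + 2 + 1), rankAlpha]
  cases m with
  | zero =>
    rw [invFacSub_of_lt u (by omega)]
    ring
  | succ m =>
    have e2 : invFacSub u (m + 1 + 2 * s + 1 + 1) (2 * (s + 2)) =
        (1 - q ^ m) * ((1 - q ^ (m + 1)) * invFac u (m + 1)) := by
      rw [show m + 1 + 2 * s + 1 + 1 = m + (2 * s + 3) by ring,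
        show 2 * (s + 2) = 2 * s + 3 + 1 by ring, invFacSub_succ hu, invFac_eq hu m]
    rw [e2]
    ring

/-- Summing `crankAlpha_step` leaves only the boundary term at `s = 0`, which cancels against the `r
= 0` summands; these fall outside the step formula. -/
theorem sum_crankAlpha_succ (hu : ∀ k, (1 - q ^ (k + 1)) * u k = 1) (n : ℕ) :
    (1 - q ^ (n + 1)) * (1 - q ^ (2 * n + 1)) * ∑ r ∈ range (n + 1 + 1), crankAlpha q r *
        (invFacSub u (n + 1) (2 * r) * invFac u (n + 1 + 2 * r)) =
      q ^ n * ∑ r ∈ range (n + 1 + 1), crankAlpha q r *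
        (invFacSub u n (2 * r) * invFac u (n + 2 * r)) := by
  have h := sum_range_sub' (fun s => (-1) ^ (s + 1) * q ^ ((s + 1) * s) *
    (invFacSub u (n + 1) (2 * (s + 1)) * invFac u (n + 2 * s + 1))) (n + 1)
  rw [← sum_congr rfl fun s _ => crankAlpha_step hu n s, sum_sub_distrib, ← mul_sum, ← mul_sum,
    invFacSub_of_lt u (show n + 1 < 2 * (n + 1 + 1) by omega)] at h
  rw [sum_range_succ', sum_range_succ' (fun r => crankAlpha q r *
        (invFacSub u n (2 * r) * invFac u (n + 2 * r)))]
  have e' : invFacSub u (n + 1) (2 * (0 + 1)) = (1 - q ^ n) * invFac u n := by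
    rw [show 2 * (0 + 1) = 0 + 1 + 1 by rfl, invFacSub_succ_succ]
    exact invFacSub_succ hu n 0
  rw [e'] at h
  simp only [mul_zero, invFacSub_zero, add_zero, crankAlpha] at h ⊢
  rw [invFac_eq hu n] at h ⊢
  linear_combination h

theorem sum_rankAlpha_succ (hu : ∀ k, (1 - q ^ (k + 1)) * u k = 1) (n : ℕ) :
    (1 - q ^ (n + 1)) * (1 - q ^ (2 * n + 1)) * ∑ r ∈ range (n + 1 + 1), rankAlpha q r *
        (invFacSub u (n + 1) (2 * r) * invFac u (n + 1 + 2 * r)) =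
      ∑ r ∈ range (n + 1 + 1), rankAlpha q r *
        (invFacSub u n (2 * r) * invFac u (n + 2 * r)) := by
  have h := sum_range_sub' (fun s => (-1) ^ (s + 1) * q ^ (3 * (s + 1) * s + n + 1) *
    (invFacSub u (n + 1) (2 * (s + 1)) * invFac u (n + 2 * s + 1))) (n + 1)
  rw [← sum_congr rfl fun s _ => rankAlpha_step hu n s, sum_sub_distrib, ← mul_sum,
    invFacSub_of_lt u (show n + 1 < 2 * (n + 1 + 1) by omega)] at h
  rw [sum_range_succ', sum_range_succ' (fun r => rankAlpha q r *
        (invFacSub u n (2 * r) * invFac u (n + 2 * r)))]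
  have e' : invFacSub u (n + 1) (2 * (0 + 1)) = (1 - q ^ n) * invFac u n := by
    rw [show 2 * (0 + 1) = 0 + 1 + 1 by rfl, invFacSub_succ_succ]
    exact invFacSub_succ hu n 0
  rw [e'] at h
  simp only [mul_zero, invFacSub_zero, add_zero, rankAlpha] at h ⊢
  rw [invFac_eq hu n] at h ⊢
  linear_combination h

/-- Both sides satisfy (1-q^{n+1})(1-q^{2n+1}) β_{n+1} = q^n β_n and equal 1 at `n = 0`. For
`rankAlpha` the factor q^n is absent. -/
theorem isBaileyPair_crankAlpha (hu : ∀ k, (1 - q ^ (k + 1)) * u k = 1) :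
    IsBaileyPair u (evenSeq (crankAlpha q))
      (fun n => q ^ (n * (n - 1) / 2) * (invFac u n * ∏ i ∈ range n, u (2 * i))) := by
  intro n
  rw [sum_range_evenSeq _ n n le_rfl]
  induction n with
  | zero => simp [crankAlpha]
  | succ n ih =>
    have h := sum_crankAlpha_succ hu n
    rw [← sum_range_evenSeq _ n (n + 1) (by omega), sum_range_evenSeq _ n n le_rfl, ← ih] at h
    have ht : (n + 1) * (n + 1 - 1) / 2 = n * (n - 1) / 2 + n := by
      cases n with
      | zero => rfl
      | succ n => simpa using tri_succ n
    beta_reduce at h ⊢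
    rw [ht, invFac_succ, prod_range_succ, pow_add]
    have h1 := hu n
    have h2 := hu (2 * n)
    generalize ∑ r ∈ range (n + 1 + 1), crankAlpha q r *
        (invFacSub u (n + 1) (2 * r) * invFac u (n + 1 + 2 * r)) = S at h ⊢
    linear_combination -(u n * u (2 * n)) * h + S * (1 - q ^ (n + 1)) * u n * h2 + S * h1

theorem isBaileyPair_rankAlpha (hu : ∀ k, (1 - q ^ (k + 1)) * u k = 1) :
    IsBaileyPair u (evenSeq (rankAlpha q)) (fun n => invFac u n * ∏ i ∈ range n, u (2 * i)) := by
  intro n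
  rw [sum_range_evenSeq _ n n le_rfl]
  induction n with
  | zero => simp [rankAlpha]
  | succ n ih =>
    have h := sum_rankAlpha_succ hu n
    rw [← sum_range_evenSeq _ n (n + 1) (by omega), sum_range_evenSeq _ n n le_rfl, ← ih] at h
    beta_reduce at h ⊢
    rw [invFac_succ, prod_range_succ]
    have h1 := hu n
    have h2 := hu (2 * n)
    generalize ∑ r ∈ range (n + 1 + 1), rankAlpha q r *
        (invFacSub u (n + 1) (2 * r) * invFac u (n + 1 + 2 * r)) = S at h ⊢
    linear_combination -(u n * u (2 * n)) * h + S * (1 - q ^ (n + 1)) * u n * h2 + S * h1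

/-! ### Gaussian binomials and a finite Durfee identity -/

/-- The Gaussian binomial coefficient as `(q; q)_n / ((q; q)_k (q; q)_{n - k})`. -/
def gaussBinom (q : A) (u : ℕ → A) (n k : ℕ) : A := qFac q n * (invFac u k * invFacSub u n k)

theorem gaussBinom_succ_succ (hu : ∀ k, (1 - q ^ (k + 1)) * u k = 1) (n k : ℕ) :
    gaussBinom q u (n + 1) (k + 1) =
      q ^ (k + 1) * gaussBinom q u n (k + 1) + gaussBinom q u n k := by
  rcases lt_or_ge n k with h | h
  · simp [gaussBinom, invFacSub_of_lt u h, invFacSub_of_lt u (show n < k + 1 by omega),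
      invFacSub_of_lt u (show n + 1 < k + 1 by omega)]
  obtain ⟨m, rfl⟩ := Nat.exists_eq_add_of_le' h
  rw [gaussBinom, gaussBinom, gaussBinom, invFacSub_succ_succ, invFacSub_add, invFacSub_succ hu,
    qFac_succ, invFac_eq hu k]
  ring

/-- A case of q-Vandermonde, whose limit in `n` is the Durfee rectangle expansion of 1/(q)_∞. The
Pascal rule trades a unit of `n` for a unit of `s`, so `s` has to vary in the induction. -/
theorem sum_gaussBinom_mul (hu : ∀ k, (1 - q ^ (k + 1)) * u k = 1) (n s : ℕ) :
    ∑ m ∈ range (n + 1), q ^ (m * (m + s)) * gaussBinom q u n m * invFac u (m + s) =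
      invFac u (n + s) := by
  induction n generalizing s with
  | zero => simp [gaussBinom]
  | succ n ih =>
    have hz (k : ℕ) : gaussBinom q u k 0 = 1 := by
      simp [gaussBinom, qFac_mul_invFac hu]
    have key : ∑ m ∈ range (n + 1 + 1), q ^ (m * (m + (s + 1))) * gaussBinom q u n m *
        invFac u (m + s) = ∑ m ∈ range (n + 1), q ^ (m * (m + (s + 1))) * gaussBinom q u n m *
        invFac u (m + s) := by
      rw [sum_range_succ, gaussBinom, invFacSub_of_lt u (Nat.lt_succ_self n)]; ring
    rw [show n + 1 + s = n + (s + 1) by ring, ← ih (s + 1), sum_range_succ', hz]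
    simp only [gaussBinom_succ_succ hu]
    rw [sum_range_succ', hz] at key
    -- Expanding 1/(q)_{m+s} = (1-q^{m+s+1})/(q)_{m+s+1} splits each summand into the two kinds that
    -- the Pascal rule produces.
    have h2 : ∀ m, q ^ (m * (m + (s + 1))) * gaussBinom q u n m * invFac u (m + (s + 1)) =
        q ^ (m * (m + (s + 1))) * gaussBinom q u n m * invFac u (m + s) +
        q ^ ((m + 1) * (m + 1 + s)) * gaussBinom q u n m * invFac u (m + 1 + s) := by
      intro m
      rw [invFac_eq hu (m + s), show m + (s + 1) = m + s + 1 by ring,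
        show m + 1 + s = m + s + 1 by ring]
      ring
    rw [sum_congr rfl fun m _ => h2 m, sum_add_distrib, ← key]
    have h3 : ∀ m, q ^ ((m + 1) * (m + 1 + s)) *
        (q ^ (m + 1) * gaussBinom q u n (m + 1) + gaussBinom q u n m) * invFac u (m + 1 + s) =
        q ^ ((m + 1) * (m + 1 + (s + 1))) * gaussBinom q u n (m + 1) * invFac u (m + 1 + s) +
        q ^ ((m + 1) * (m + 1 + s)) * gaussBinom q u n m * invFac u (m + 1 + s) := by
      intro m; ring
    rw [sum_congr rfl fun m _ => h3 m, sum_add_distrib]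
    simp only [zero_mul]
    ring

end Bailey

/-! ### Coefficientwise limits of Bailey pairs -/

section Limits

open Finset

variable {R : Type*} [CommRing R]

/-- The limiting identities below are proved through congruences modulo powers of `X`. -/
theorem eq_of_forall_X_pow_dvd_sub {a b : R⟦X⟧} (h : ∀ N, X ^ N ∣ a - b) : a = b := by
  ext n
  have := X_pow_dvd_iff.mp (h (n + 1)) n (Nat.lt_succ_self n)
  rwa [map_sub, sub_eq_zero] at this

/-- The inverse of `1 - c X ^ (k + 1)`. -/
noncomputable def geo (c : R) (k : ℕ) : R⟦X⟧ := invOfUnit (1 - C c * X ^ (k + 1)) 1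

theorem one_sub_mul_geo (c : R) (k : ℕ) : (1 - C c * X ^ (k + 1)) * geo c k = 1 :=
  mul_invOfUnit _ 1 (by simp)

theorem one_sub_mul_geo_one (k : ℕ) : (1 - X ^ (k + 1)) * geo (1 : R) k = 1 := by
  simpa using one_sub_mul_geo (1 : R) k

theorem X_pow_dvd_geo_sub_one (c : R) (k : ℕ) : X ^ (k + 1) ∣ geo c k - 1 :=
  ⟨C c * geo c k, by linear_combination one_sub_mul_geo c k⟩

theorem X_pow_dvd_invFac_add_sub (c : R) (m k : ℕ) :
    X ^ (m + 1) ∣ invFac (geo c) (m + k) - invFac (geo c) m := by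
  induction k with
  | zero => simp
  | succ k ih =>
    rw [← add_assoc, invFac_succ]
    have h : (X : R⟦X⟧) ^ (m + 1) ∣ geo c (m + k) - 1 :=
      (pow_dvd_pow _ (by omega)).trans (X_pow_dvd_geo_sub_one c (m + k))
    have := (h.mul_left (invFac (geo c) (m + k))).add ih
    convert this using 1; ring

/-- The weight in the finite Bailey lemma tends to 1. The precision lost as `r` grows is recovered
from the factor `X ^ r` that accompanies it. -/
theorem X_pow_dvd_qFac_sq_mul_sub_one {N r : ℕ} (h : r ≤ N) :
    X ^ (N - r + 1) ∣ qFac (X : R⟦X⟧) N ^ 2 *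
      (invFacSub (geo 1) N r * invFac (geo 1) (N + r)) - 1 := by
  obtain ⟨m, rfl⟩ := Nat.exists_eq_add_of_le' h
  rw [invFacSub_add, Nat.add_sub_cancel]
  have h1 := X_pow_dvd_invFac_add_sub (1 : R) m r
  have h2 : (X : R⟦X⟧) ^ (m + 1) ∣ _ :=
    (pow_dvd_pow X (by omega)).trans (X_pow_dvd_invFac_add_sub (1 : R) (m + r) r)
  have h3 := qFac_mul_invFac (one_sub_mul_geo_one (R := R)) (m + r)
  have := ((h2.mul_left (invFac (geo 1) m)).sub (h1.mul_left (invFac (geo 1) (m + r)))).mul_left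
    (qFac (X : R⟦X⟧) (m + r) ^ 2)
  convert this using 1
  linear_combination (qFac X (m + r) * invFac (geo 1) (m + r) + 1) * h3

theorem X_pow_dvd_sum_durfee_sub (A s : ℕ) :
    X ^ (A + 1) ∣ ∑ m ∈ range (A + 1), (X : R⟦X⟧) ^ (m * (m + s)) *
      (invFac (geo 1) m * invFac (geo 1) (m + s)) - invFac (geo 1) (A + s) := by
  rw [← sum_gaussBinom_mul one_sub_mul_geo_one A s, ← sum_sub_distrib]
  refine dvd_sum fun m hm => ?_
  obtain ⟨k, rfl⟩ := Nat.exists_eq_add_of_le' (Nat.lt_succ_iff.mp (mem_range.mp hm))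
  rw [gaussBinom, invFacSub_add]
  have h1 := mul_dvd_mul (pow_dvd_pow (X : R⟦X⟧) (show m ≤ m * (m + s) from
    (Nat.le_mul_self m).trans (Nat.mul_le_mul_left m (Nat.le_add_right m s))))
    (X_pow_dvd_invFac_add_sub (1 : R) k m)
  have h3 := qFac_mul_invFac (one_sub_mul_geo_one (R := R)) (k + m)
  rw [← pow_add, show m + (k + 1) = k + m + 1 by ring] at h1
  convert h1.mul_left (qFac X (k + m) * invFac (geo 1) m * invFac (geo 1) (m + s)) using 1
  linear_combination -(X ^ (m * (m + s)) * (invFac (geo 1) m * invFac (geo 1) (m + s))) * h3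

theorem le_order_of_X_pow_dvd {f : R⟦X⟧} {n : ℕ} (h : X ^ n ∣ f) : (n : ℕ∞) ≤ f.order :=
  nat_le_order _ _ (X_pow_dvd_iff.mp h)

variable [TopologicalSpace R]

theorem summable_of_X_pow_dvd {f : ℕ → R⟦X⟧} (h : ∀ n, X ^ n ∣ f n) : Summable f := by
  apply WithPiTopology.summable_of_tendsto_order_atTop_nhds_top
  rw [ENat.tendsto_nhds_top_iff_natCast_lt]
  intro m
  filter_upwards [Filter.eventually_gt_atTop m] with k hk
  exact lt_of_lt_of_le (by exact_mod_cast hk) (le_order_of_X_pow_dvd (h k))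

variable [T2Space R]

theorem X_pow_dvd_tsum {ι : Type*} {f : ι → R⟦X⟧} {N : ℕ} (h : ∀ i, X ^ N ∣ f i) :
    X ^ N ∣ ∑' i, f i := by
  by_cases hf : Summable f
  · rw [X_pow_dvd_iff]
    intro m hm
    rw [hf.map_tsum (coeff m) (WithPiTopology.continuous_coeff R m)]
    simp [fun i => X_pow_dvd_iff.mp (h i) m hm]
  · simp [tsum_eq_zero_of_not_summable hf]

variable [IsTopologicalRing R]

theorem X_pow_dvd_tsum_sub_sum_range {f : ℕ → R⟦X⟧} (h : ∀ n, X ^ n ∣ f n) (N : ℕ) :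
    X ^ N ∣ ∑' n, f n - ∑ n ∈ range N, f n := by
  rw [← (summable_of_X_pow_dvd h).sum_add_tsum_nat_add N, add_sub_cancel_left]
  exact X_pow_dvd_tsum fun n => (pow_dvd_pow X (by omega)).trans (h (n + N))

/-- The limit `N → ∞` of `IsBaileyPair.sum_range_qFac_sq`. -/
theorem IsBaileyPair.tsum_qFac_sq {α β : ℕ → R⟦X⟧} (h : IsBaileyPair (geo 1) α β) :
    ∑' n, X ^ (n + 1) * qFac X n ^ 2 * β (n + 1) =
      α 0 * ∑' k, X ^ (k + 1) * geo 1 k ^ 2 + ∑' r, α (r + 1) * (X ^ (r + 1) * geo 1 r ^ 2) := by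
  have hd (n : ℕ) : (X : R⟦X⟧) ^ n ∣ X ^ (n + 1) := pow_dvd_pow X (by omega)
  refine eq_of_forall_X_pow_dvd_sub fun N => ?_
  have h1 := X_pow_dvd_tsum_sub_sum_range
    (fun n => ((hd n).mul_right (qFac X n ^ 2)).mul_right (β (n + 1))) N
  have h2 := X_pow_dvd_tsum_sub_sum_range (fun n => (hd n).mul_right (geo (1 : R) n ^ 2)) N
  have h3 := X_pow_dvd_tsum_sub_sum_range
    (fun n => ((hd n).mul_right (geo (1 : R) n ^ 2)).mul_left (α (n + 1))) N
  rw [h.sum_range_qFac_sq one_sub_mul_geo_one N] at h1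
  have h4 : (X : R⟦X⟧) ^ N ∣ ∑ r ∈ range N, α (r + 1) * (X ^ (r + 1) * geo 1 r ^ 2 *
        (qFac X N ^ 2 * (invFacSub (geo 1) N (r + 1) * invFac (geo 1) (N + (r + 1))))) -
      ∑ r ∈ range N, α (r + 1) * (X ^ (r + 1) * geo 1 r ^ 2) := by
    rw [← sum_sub_distrib]
    refine dvd_sum fun r hr => ?_
    have hr : r + 1 ≤ N := mem_range.mp hr
    have h5 := (mul_dvd_mul_left (X ^ (r + 1)) (X_pow_dvd_qFac_sq_mul_sub_one (R := R) hr)).mul_left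
      (α (r + 1) * geo 1 r ^ 2)
    rw [← pow_add] at h5
    convert (pow_dvd_pow X (show N ≤ r + 1 + (N - (r + 1) + 1) by omega)).trans h5 using 1
    ring
  convert ((h1.sub (h2.mul_left (α 0))).sub h3).add h4 using 1
  ring

/-- The Bailey lemma with both parameters tending to infinity. After exchanging the sums, the
coefficient of `α r` is `X ^ (r ^ 2)` times a Durfee rectangle sum, which approximates 1/(X;X)_∞;
the hypothesis on `E` says that it is this series. -/
theorem IsBaileyPair.tsum_X_pow_sq {α β : ℕ → R⟦X⟧} (h : IsBaileyPair (geo 1) α β) {E : R⟦X⟧}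
    (hE : ∀ N, X ^ (N + 1) ∣ E - invFac (geo 1) N) :
    ∑' n, X ^ (n ^ 2) * β n = E * ∑' r, X ^ (r ^ 2) * α r := by
  have hd (n : ℕ) : (X : R⟦X⟧) ^ n ∣ X ^ (n ^ 2) := pow_dvd_pow X (by nlinarith)
  refine eq_of_forall_X_pow_dvd_sub fun N => (pow_dvd_pow X (Nat.le_succ N)).trans ?_
  have h1 := X_pow_dvd_tsum_sub_sum_range (fun n => (hd n).mul_right (β n)) (N + 1)
  have h2 := X_pow_dvd_tsum_sub_sum_range (fun n => (hd n).mul_right (α n)) (N + 1)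
  have h3 : ∑ n ∈ range (N + 1), X ^ (n ^ 2) * β n = ∑ r ∈ range (N + 1), α r *
      ∑ n ∈ range (N + 1), X ^ (n ^ 2) * (invFacSub (geo 1) n r * invFac (geo 1) (n + r)) := by
    simp_rw [mul_sum]
    rw [sum_comm]
    refine sum_congr rfl fun n hn => ?_
    rw [h n, mul_sum]
    refine (sum_congr rfl fun r _ => ?_).trans (sum_subset
      (range_subset_range.mpr (mem_range.mp hn)) fun r _ hr => ?_)
    · ring
    · rw [invFacSub_of_lt _ (by simpa using hr)]; ring
  have h4 : (X : R⟦X⟧) ^ (N + 1) ∣ ∑ n ∈ range (N + 1), X ^ (n ^ 2) * β n -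
      E * ∑ r ∈ range (N + 1), X ^ (r ^ 2) * α r := by
    rw [h3, mul_sum, ← sum_sub_distrib]
    refine dvd_sum fun r hr => ?_
    obtain ⟨A, rfl⟩ := Nat.exists_eq_add_of_le (Nat.lt_succ_iff.mp (mem_range.mp hr))
    have h5 : ∑ n ∈ range (r + A + 1), (X : R⟦X⟧) ^ (n ^ 2) *
        (invFacSub (geo 1) n r * invFac (geo 1) (n + r)) = X ^ (r ^ 2) *
        ∑ m ∈ range (A + 1), X ^ (m * (m + 2 * r)) *
          (invFac (geo 1) m * invFac (geo 1) (m + 2 * r)) := by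
      -- Terms with `n < r` vanish; `n = m + r` gives n² = r² + m(m + 2r).
      rw [add_assoc, sum_range_add, sum_eq_zero fun n hn => by
        rw [invFacSub_of_lt _ (mem_range.mp hn)]; ring, zero_add, mul_sum]
      refine sum_congr rfl fun m _ => ?_
      rw [add_comm r m, invFacSub_add, show m + r + r = m + 2 * r by ring]
      ring
    rw [h5]
    have h6 := (X_pow_dvd_sum_durfee_sub (R := R) A (2 * r)).sub
      ((pow_dvd_pow X (by omega)).trans (hE (A + 2 * r)))
    have h7 := (mul_dvd_mul (hd r) h6).mul_left (α r)
    rw [← pow_add, ← add_assoc] at h7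
    convert h7 using 1
    ring
  convert (h1.add h4).sub (h2.mul_left E) using 1
  ring

end Limits

/-! ### Two-variable series for the rank and the crank -/

section TwoVariable

open Finset

variable {R : Type*} [CommRing R]

/-- With t = X^{k+1}, `y * z = 1` gives (1-yt)(1-zt) = (1-t)² - (y+z-2)t; as y+z-2 squares to zero,
the inverse is linear in it. -/
theorem geo_mul_geo {y z : R} (hyz : y * z = 1) (hw : (y + z - 2) ^ 2 = 0) (k : ℕ) :
    geo y k * geo z k =
      geo 1 k ^ 2 * (1 + C (y + z - 2) * (X ^ (k + 1) * geo 1 k ^ 2)) := by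
  have hy := one_sub_mul_geo y k
  have hz := one_sub_mul_geo z k
  have hu := one_sub_mul_geo_one (R := R) k
  have hyz' : (C y * C z : R⟦X⟧) = 1 := by rw [← map_mul, hyz, map_one]
  have hw' : (C y + C z - 2 : R⟦X⟧) ^ 2 = 0 := by
    have : (C ((y + z - 2) ^ 2) : R⟦X⟧) = 0 := by rw [hw, map_zero]
    simpa [show (C 2 : R⟦X⟧) = 2 from map_ofNat C 2] using this
  have e : (1 - C y * X ^ (k + 1)) * (1 - C z * X ^ (k + 1)) *
      (geo 1 k ^ 2 * (1 + C (y + z - 2) * (X ^ (k + 1) * geo 1 k ^ 2))) = 1 := by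
    have h1 : (1 - X ^ (k + 1)) ^ 2 * geo (1 : R) k ^ 2 = 1 := by rw [← mul_pow, hu, one_pow]
    have h2 : (C (y + z - 2) : R⟦X⟧) = C y + C z - 2 := by
      simp [show (C 2 : R⟦X⟧) = 2 from map_ofNat C 2]
    rw [h2]
    have h3 : (1 - C y * X ^ (k + 1)) * (1 - C z * X ^ (k + 1)) =
        (1 - X ^ (k + 1)) ^ 2 - (C y + C z - 2) * X ^ (k + 1) := by
      linear_combination X ^ (k + 1) * X ^ (k + 1) * hyz'
    rw [h3]
    linear_combination (1 + (C y + C z - 2) * (X ^ (k + 1) * geo 1 k ^ 2)) * h1 -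
      X ^ (k + 1) * X ^ (k + 1) * geo 1 k ^ 4 * hw'
  have e' : (1 - C y * X ^ (k + 1)) * (1 - C z * X ^ (k + 1)) * (geo y k * geo z k) = 1 := by
    linear_combination (1 - C z * X ^ (k + 1)) * geo z k * hy + hz
  linear_combination -(geo y k * geo z k) * e +
    geo 1 k ^ 2 * (1 + C (y + z - 2) * (X ^ (k + 1) * geo 1 k ^ 2)) * e'

theorem invFac_geo_mul_invFac_geo {y z : R} (hyz : y * z = 1) (hw : (y + z - 2) ^ 2 = 0) (n : ℕ) :
    invFac (geo y) n * invFac (geo z) n = invFac (geo 1) n ^ 2 *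
      (1 + C (y + z - 2) * ∑ k ∈ range n, X ^ (k + 1) * geo 1 k ^ 2) := by
  have hw' : (C (y + z - 2) : R⟦X⟧) ^ 2 = 0 := by rw [← map_pow, hw, map_zero]
  induction n with
  | zero => simp
  | succ n ih =>
    rw [invFac_succ, invFac_succ, invFac_succ, sum_range_succ]
    have h := geo_mul_geo hyz hw n
    generalize hW : (C (y + z - 2) : R⟦X⟧) = W at *
    linear_combination geo y n * geo z n * ih + invFac (geo 1) n ^ 2 *
      (1 + W * ∑ k ∈ range n, X ^ (k + 1) * geo 1 k ^ 2) * h +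
      invFac (geo 1) n ^ 2 * (∑ k ∈ range n, X ^ (k + 1) * geo 1 k ^ 2) * geo 1 n ^ 2 *
        (X ^ (n + 1) * geo 1 n ^ 2) * hw'

theorem X_pow_dvd_C_mul_X_pow (c : R) (j n : ℕ) : (X : R⟦X⟧) ^ n ∣ (C c * X ^ (j + 1)) ^ n :=
  pow_dvd_pow_of_dvd ((dvd_pow_self X (Nat.succ_ne_zero j)).mul_left _) n

theorem X_pow_dvd_prod_sub_one {ι : Type*} {N : ℕ} (s : Finset ι) {f : ι → R⟦X⟧}
    (h : ∀ i ∈ s, X ^ N ∣ f i - 1) : X ^ N ∣ ∏ i ∈ s, f i - 1 := by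
  classical
  induction s using Finset.induction_on with
  | empty => simp
  | insert a s ha ih =>
    rw [prod_insert ha]
    convert ((h a (mem_insert_self a s)).mul_right (∏ i ∈ s, f i)).add
      (ih fun i hi => h i (mem_insert_of_mem hi)) using 1
    ring

/-! ### The series of Fine, Euler and the q-binomial theorem -/

variable [TopologicalSpace R]

/-- The series `∑ tⁿ / (b; X)_n` with `t = y X ^ (j + 1)` and `b = z X ^ (j + 2)`. -/
noncomputable def fineSeries (y z : R) (j : ℕ) : R⟦X⟧ :=
  ∑' n, (C y * X ^ (j + 1)) ^ n * ∏ i ∈ range n, geo z (j + 1 + i)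

theorem summable_fineSeries (y z : R) (j : ℕ) :
    Summable fun n => (C y * X ^ (j + 1)) ^ n * ∏ i ∈ range n, geo z (j + 1 + i) :=
  summable_of_X_pow_dvd fun n => (X_pow_dvd_C_mul_X_pow y j n).mul_right _

/-- Euler's series `∑ (c X ^ (j + 1)) ^ n / (X; X)_n`. -/
noncomputable def eulerSeries (c : R) (j : ℕ) : R⟦X⟧ :=
  ∑' n, (C c * X ^ (j + 1)) ^ n * invFac (geo 1) n

theorem summable_eulerSeries (c : R) (j : ℕ) :
    Summable fun n => (C c * X ^ (j + 1)) ^ n * invFac (geo 1) n :=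
  summable_of_X_pow_dvd fun n => (X_pow_dvd_C_mul_X_pow c j n).mul_right _

/-- The series `∑ (a; X)_n (z X) ^ n / (X; X)_n` with `a = y X ^ (j + 1)`. -/
noncomputable def qBinomSeries (y z : R) (j : ℕ) : R⟦X⟧ :=
  ∑' n, (C z * X ^ (0 + 1)) ^ n * (invFac (geo 1) n * ∏ i ∈ range n, (1 - C y * X ^ (j + 1 + i)))

theorem summable_qBinomSeries (y z : R) (j : ℕ) :
    Summable fun n => (C z * X ^ (0 + 1)) ^ n *
      (invFac (geo 1) n * ∏ i ∈ range n, (1 - C y * X ^ (j + 1 + i))) :=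
  summable_of_X_pow_dvd fun n => (X_pow_dvd_C_mul_X_pow z 0 n).mul_right _

variable [T2Space R] [IsTopologicalRing R]

/-- With t = yX^{j+1} and P_n the product in the nth term, t^{n+1}(P_{n+1} - P_n) carries a factor
`y ^ (n + 1) * z = y ^ n`, hence is a multiple of the nth term of the series at `j + 1`. -/
theorem one_sub_mul_fineSeries {y z : R} (hyz : y * z = 1) (j : ℕ) :
    (1 - C y * X ^ (j + 1)) * fineSeries y z j =
      1 + X ^ (2 * j + 3) * geo z (j + 1) * fineSeries y z (j + 1) := by
  have hs := summable_fineSeries y z j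
  have hyz' : (C y * C z : R⟦X⟧) = 1 := by rw [← map_mul, hyz, map_one]
  have h0 := hs.tsum_eq_zero_add
  rw [range_zero, prod_empty, pow_zero, mul_one] at h0
  have hs' := (summable_nat_add_iff 1).mpr hs
  rw [sub_mul, one_mul]
  nth_rw 1 [fineSeries]
  rw [h0, fineSeries, fineSeries, ← hs.tsum_mul_left, ← (summable_fineSeries y z (j + 1)).tsum_mul_left,
    add_sub_assoc, ← hs'.tsum_sub (hs.mul_left _)]
  congr 1
  refine tsum_congr fun n => ?_
  have h1 := prod_range_succ (fun i => geo z (j + 1 + i)) n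
  have h2 := prod_range_succ' (fun i => geo z (j + 1 + i)) n
  rw [prod_congr rfl fun i _ => congrArg (geo z) (show j + 1 + (i + 1) = j + 1 + 1 + i by ring),
    add_zero] at h2
  have h3 := one_sub_mul_geo z (j + 1 + n)
  have h4 : ∏ i ∈ range n, geo z (j + 1 + i) = (1 - C z * X ^ (j + 1 + n + 1)) *
      ∏ i ∈ range (n + 1), geo z (j + 1 + i) := by
    rw [h1]; linear_combination -(∏ i ∈ range n, geo z (j + 1 + i)) * h3
  rw [h4, h2]
  generalize ∏ i ∈ range n, geo z (j + 1 + 1 + i) = Q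
  have e : (C y : R⟦X⟧) ^ (n + 1) * C z = C y ^ n := by
    rw [pow_succ, mul_assoc, hyz', mul_one]
  rw [mul_pow, mul_pow]
  linear_combination X ^ ((j + 1) * (n + 1) + (j + 1 + n + 1)) * Q * geo z (j + 1) * e

/-- Iteration of `one_sub_mul_fineSeries`: the exponents 2N+3 accumulate to the squares, which
converts the sum over largest parts into the sum over Durfee squares. -/
theorem one_add_fineSeries_eq_sum {y z : R} (hyz : y * z = 1) (N : ℕ) :
    1 + X * (geo z 0 * fineSeries y z 0) =
      ∑ n ∈ range (N + 1), X ^ (n ^ 2) * (invFac (geo y) n * invFac (geo z) n) +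
      X ^ ((N + 1) ^ 2) * (invFac (geo y) N * invFac (geo z) N * (geo z N * fineSeries y z N)) := by
  induction N with
  | zero => simp
  | succ N ih =>
    rw [ih, sum_range_succ _ (N + 1), add_assoc]
    congr 1
    have h : fineSeries y z N = geo y N *
        (1 + X ^ (2 * N + 3) * geo z (N + 1) * fineSeries y z (N + 1)) := by
      rw [← one_sub_mul_fineSeries hyz]
      linear_combination -(fineSeries y z N) * one_sub_mul_geo y N
    rw [h, invFac_succ, invFac_succ]
    ring

theorem one_sub_mul_eulerSeries (c : R) (j : ℕ) :
    (1 - C c * X ^ (j + 1)) * eulerSeries c j = eulerSeries c (j + 1) := by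
  have hs := summable_eulerSeries c j
  have hs1 := summable_eulerSeries c (j + 1)
  have h : eulerSeries c j - eulerSeries c (j + 1) = C c * X ^ (j + 1) * eulerSeries c j := by
    rw [eulerSeries, eulerSeries, ← hs.tsum_sub hs1, (hs.sub hs1).tsum_eq_zero_add,
      ← hs.tsum_mul_left]
    simp only [pow_zero, sub_self, zero_add]
    refine tsum_congr fun n => ?_
    rw [invFac_eq one_sub_mul_geo_one n]
    ring
  linear_combination h

theorem X_pow_dvd_eulerSeries_sub_one (c : R) (j : ℕ) : X ^ (j + 1) ∣ eulerSeries c j - 1 := by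
  rw [eulerSeries, (summable_eulerSeries c j).tsum_eq_zero_add, invFac_zero, pow_zero, mul_one,
    add_sub_cancel_left]
  exact X_pow_dvd_tsum fun n => by
    rw [pow_succ]; exact ((dvd_mul_left _ _).mul_left _).mul_right _

/-- In the limit `N → ∞` this is Euler's evaluation of the series as 1/(cX;X)_∞. -/
theorem eulerSeries_zero_eq (c : R) (N : ℕ) :
    eulerSeries c 0 = invFac (geo c) N * eulerSeries c N := by
  induction N with
  | zero => simp
  | succ N ih =>
    rw [ih, ← one_sub_mul_eulerSeries, invFac_succ]
    linear_combination -(invFac (geo c) N * eulerSeries c N) * one_sub_mul_geo c N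

theorem X_pow_dvd_eulerSeries_zero_sub (c : R) (N : ℕ) :
    X ^ (N + 1) ∣ eulerSeries c 0 - invFac (geo c) N := by
  convert (X_pow_dvd_eulerSeries_sub_one c N).mul_left (invFac (geo c) N) using 1
  rw [eulerSeries_zero_eq c N]; ring

/-- The q-binomial theorem evaluates the series as (azX;X)_∞/(zX;X)_∞ with a = yX^{j+1}. Here az =
X^{j+1} is free of `y`, so raising `j` removes one factor. -/
theorem qBinomSeries_eq {y z : R} (hyz : y * z = 1) (j : ℕ) :
    qBinomSeries y z j = (1 - X ^ (j + 2)) * qBinomSeries y z (j + 1) := by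
  have hs := summable_qBinomSeries y z j
  have hs1 := summable_qBinomSeries y z (j + 1)
  have hyz' : (C y * C z : R⟦X⟧) = 1 := by rw [← map_mul, hyz, map_one]
  have h : qBinomSeries y z j - qBinomSeries y z (j + 1) =
      -(X ^ (j + 2)) * qBinomSeries y z (j + 1) := by
    rw [qBinomSeries, qBinomSeries, ← hs.tsum_sub hs1, (hs.sub hs1).tsum_eq_zero_add,
      ← hs1.tsum_mul_left]
    simp only [pow_zero, range_zero, prod_empty, sub_self, zero_add]
    refine tsum_congr fun n => ?_
    have h1 := prod_range_succ' (fun i => (1 - C y * X ^ (j + 1 + i) : R⟦X⟧)) n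
    rw [prod_congr rfl fun i _ => congrArg (fun m => (1 - C y * X ^ m : R⟦X⟧))
      (show j + 1 + (i + 1) = j + 1 + 1 + i by ring), add_zero] at h1
    rw [h1, prod_range_succ, invFac_eq one_sub_mul_geo_one n]
    generalize ∏ i ∈ range n, (1 - C y * X ^ (j + 1 + 1 + i) : R⟦X⟧) = Q
    rw [mul_pow, mul_pow, pow_succ (C z)]
    linear_combination -(C z ^ n * X ^ (n + 1) * X ^ (j + 1) * (1 - X ^ (n + 1)) *
      invFac (geo 1) (n + 1) * Q) * hyz'
  linear_combination h

theorem one_sub_mul_qBinomSeries_zero {y z : R} (hyz : y * z = 1) (N : ℕ) :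
    (1 - X) * qBinomSeries y z 0 = qFac X (N + 1) * qBinomSeries y z N := by
  induction N with
  | zero => simp [qFac_succ]
  | succ N ih => rw [ih, qBinomSeries_eq hyz, qFac_succ X (N + 1)]; ring

theorem X_pow_dvd_qBinomSeries_sub (y z : R) (N : ℕ) :
    X ^ (N + 1) ∣ qBinomSeries y z N - eulerSeries z 0 := by
  rw [qBinomSeries, eulerSeries, ← (summable_qBinomSeries y z N).tsum_sub
    (summable_eulerSeries z 0)]
  refine X_pow_dvd_tsum fun n => ?_
  have h : (X : R⟦X⟧) ^ (N + 1) ∣ ∏ i ∈ range n, (1 - C y * X ^ (N + 1 + i)) - 1 := by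
    refine X_pow_dvd_prod_sub_one _ fun i _ => ⟨-(C y * X ^ i), by ring⟩
  convert h.mul_left ((C z * X ^ (0 + 1)) ^ n * invFac (geo 1) n) using 1
  ring

/-- Raising `j` to infinity sends a to 0 and leaves Euler's series, so (1-X) times the q-binomial
series is (X;X)_∞/(zX;X)_∞. -/
theorem X_pow_dvd_one_sub_mul_qBinomSeries_sub {y z : R} (hyz : y * z = 1) (N : ℕ) :
    X ^ (N + 1) ∣ (1 - X) * qBinomSeries y z 0 * invFac (geo y) N -
      qFac X N * (invFac (geo y) N * invFac (geo z) N) := by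
  have h1 := (X_pow_dvd_qBinomSeries_sub y z N).add (X_pow_dvd_eulerSeries_zero_sub z N)
  have h2 : (X : R⟦X⟧) ^ (N + 1) ∣ qFac X (N + 1) - qFac X N :=
    ⟨-qFac X N, by rw [qFac_succ]; ring⟩
  rw [one_sub_mul_qBinomSeries_zero hyz N]
  convert (h1.mul_left (qFac X (N + 1) * invFac (geo y) N)).add
    (h2.mul_left (invFac (geo y) N * invFac (geo z) N)) using 1
  ring

end TwoVariable

/-! ### Weighted generating functions of partitions -/

section Partitions

open Finset Nat.Partition

variable {R : Type*} [CommRing R]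

theorem toFinsupp_prod_pow {n : ℕ} (p : n.Partition) (b : ℕ → R) :
    p.parts.toFinsupp.prod (fun i j => b i ^ j) = (p.parts.map b).prod := by
  rw [Finset.prod_multiset_map_count, Finsupp.prod, Multiset.toFinsupp_support]
  simp

theorem toFinsupp_prod_ite_one {n : ℕ} (p : n.Partition) (a : ℕ → R) :
    p.parts.toFinsupp.prod (fun i j => if i = 1 then a j else 1) =
      if p.parts.count 1 = 0 then 1 else a (p.parts.count 1) := by
  rw [Finsupp.prod, Multiset.toFinsupp_support, Finset.prod_ite_eq']
  simp only [Multiset.mem_toFinset, Multiset.count_eq_zero, Multiset.toFinsupp_apply, ite_not]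

theorem prod_map_ite_le {n : ℕ} (p : n.Partition) (b : ℕ → R) (L : ℕ) :
    (p.parts.map fun i => if i ≤ L then b i else 0).prod =
      if p.largestPart ≤ L then (p.parts.map b).prod else 0 := by
  split_ifs with h
  · congr 1
    refine Multiset.map_congr rfl fun i hi => if_pos ((Multiset.le_sup hi).trans h)
  · rw [largestPart, Multiset.sup_le] at h
    push Not at h
    obtain ⟨i, hi, hL⟩ := h
    exact Multiset.prod_eq_zero (Multiset.mem_map.mpr ⟨i, hi, if_neg (by omega)⟩)

theorem largestPart_le {n : ℕ} (p : n.Partition) : p.largestPart ≤ n := by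
  rw [largestPart, Multiset.sup_le]
  exact fun i hi => (Multiset.le_sum_of_mem hi).trans p.parts_sum.le

theorem count_one_le {n : ℕ} (p : n.Partition) : p.parts.count 1 ≤ n := by
  have h1 : p.parts.count 1 ≤ p.parts.card := Multiset.count_le_card 1 _
  have h2 := Multiset.card_nsmul_le_sum (s := p.parts) (a := 1) fun i hi => p.parts_pos hi
  rw [p.parts_sum] at h2
  simp at h2
  omega

theorem sum_range_mul_ite_sub (F : ℕ → R) {k n : ℕ} (h : k ≤ n) :
    F 0 * (if k ≤ 0 then 1 else 0) + ∑ L ∈ range n, F (L + 1) *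
      ((if k ≤ L + 1 then 1 else 0) - (if k ≤ L then 1 else 0)) = F k := by
  cases k with
  | zero => simp
  | succ k =>
    rw [sum_eq_single k]
    · simp
    · intro L _ hL
      rcases lt_or_gt_of_ne hL with h | h
      · rw [if_neg (by omega), if_neg (by omega)]; ring
      · rw [if_pos (by omega), if_pos (by omega)]; ring
    · intro hk; simp at hk; omega

theorem prod_map_ite_lt {s : Multiset ℕ} (y : R) (ω : ℕ) :
    (s.map fun i => if i ≤ ω then 1 else y).prod = y ^ (s.filter fun i => ω < i).card := by
  induction s using Multiset.induction_on with
  | empty => simp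
  | cons a s ih =>
    rw [Multiset.map_cons, Multiset.prod_cons, ih]
    rcases le_or_gt a ω with h | h
    · rw [if_pos h, one_mul, Multiset.filter_cons_of_neg _ (by omega)]
    · rw [if_neg (by omega), Multiset.filter_cons_of_pos _ h, Multiset.card_cons, pow_succ']

theorem coeff_eq_of_X_pow_dvd_sub {a b : R⟦X⟧} {n N : ℕ} (h : X ^ N ∣ a - b) (hn : n < N) :
    coeff n a = coeff n b := by
  have := X_pow_dvd_iff.mp h n hn
  rwa [map_sub, sub_eq_zero] at this

variable [TopologicalSpace R] [T2Space R]

theorem genFun_eq_prod_range (f : ℕ → ℕ → R) (M : ℕ) (hf : ∀ i j, M < i → f i (j + 1) = 0) :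
    genFun f = ∏ i ∈ range M, (1 + ∑' j, f (i + 1) (j + 1) • X ^ ((i + 1) * (j + 1))) := by
  rw [genFun_eq_tprod]
  refine tprod_eq_prod fun i hi => ?_
  have hi : M < i + 1 := by simp at hi; omega
  simp [hf _ _ hi]

variable [IsTopologicalRing R]

theorem one_add_tsum_pow_eq_geo (c : R) (i : ℕ) :
    1 + ∑' j, c ^ (j + 1) • (X : R⟦X⟧) ^ ((i + 1) * (j + 1)) = geo c i := by
  have h0 : constantCoeff (C c * X ^ (i + 1) : R⟦X⟧) = 0 := by simp
  have h1 := WithPiTopology.one_sub_mul_tsum_pow_of_constantCoeff_eq_zero h0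
  have h2 := (WithPiTopology.summable_pow_of_constantCoeff_eq_zero h0).tsum_eq_zero_add
  have h3 : ∀ j, c ^ (j + 1) • (X : R⟦X⟧) ^ ((i + 1) * (j + 1)) = (C c * X ^ (i + 1)) ^ (j + 1) := by
    intro j
    rw [smul_eq_C_mul, map_pow, mul_pow, ← pow_mul]
  simp_rw [h3]
  rw [pow_zero] at h2
  rw [← h2]
  linear_combination geo c i * h1 -
    (∑' j, (C c * X ^ (i + 1) : R⟦X⟧) ^ j) * one_sub_mul_geo c i

theorem sum_partition_prod (b : ℕ → R) (M n : ℕ) (hb : ∀ i, M < i → b i = 0) :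
    ∑ p : n.Partition, (p.parts.map b).prod = coeff n (∏ i ∈ range M, geo (b (i + 1)) i) := by
  have h := genFun_eq_prod_range (fun i j => b i ^ j) M (fun i j hi => by simp [hb i hi])
  simp_rw [one_add_tsum_pow_eq_geo] at h
  rw [← h, coeff_genFun]
  simp_rw [toFinsupp_prod_pow]

/-- Weighting the multiplicity of the part 1 by the indicator of `ω` counts partitions with no ones
or with `ω` ones, since the factor of `genFun` always contains the empty choice. Subtracting the
series with weight 0 leaves the latter. -/
theorem sum_partition_count_one (b : ℕ → R) (M n ω : ℕ) (hM : 1 ≤ M) (hω : ω ≠ 0) (hb1 : b 1 = 1)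
    (hb : ∀ i, M < i → b i = 0) :
    ∑ p : n.Partition, (if p.parts.count 1 = ω then (p.parts.map b).prod else 0) =
      coeff n (X ^ ω * ((1 - X) * ∏ i ∈ range M, geo (b (i + 1)) i)) := by
  have key (a : ℕ → R) : genFun (fun i j => (if i = 1 then a j else 1) * b i ^ j) =
      (1 + ∑' j, a (j + 1) • X ^ (j + 1)) * ((1 - X) * ∏ i ∈ range M, geo (b (i + 1)) i) := by
    rw [genFun_eq_prod_range _ M (fun i j hi => by simp [hb i hi])]
    obtain ⟨M, rfl⟩ := Nat.exists_eq_add_of_le' hM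
    rw [prod_range_succ', prod_range_succ']
    have hne (i : ℕ) : ¬ i + 1 + 1 = 1 := by omega
    simp only [hne, if_false, one_mul, zero_add, if_true, hb1, one_pow, mul_one,
      one_add_tsum_pow_eq_geo]
    have h1 := one_sub_mul_geo_one (R := R) 0
    rw [zero_add, pow_one] at h1
    linear_combination -(∏ i ∈ range M, geo (b (i + 1 + 1)) (i + 1)) *
      (1 + ∑' j, a (j + 1) • (X : R⟦X⟧) ^ (j + 1)) * h1
  have h1 := congrArg (coeff n) (key fun j => if j = ω then 1 else 0)
  have h0 := congrArg (coeff n) (key fun _ => 0)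
  obtain ⟨ω, rfl⟩ := Nat.exists_eq_succ_of_ne_zero hω
  have e : ∑' j, (if j + 1 = ω.succ then (1 : R) else 0) • (X : R⟦X⟧) ^ (j + 1) = X ^ (ω + 1) := by
    rw [tsum_eq_single ω]
    · simp
    · intro j hj; simp [hj]
  rw [e] at h1
  simp only [zero_smul, tsum_zero, add_zero, one_mul] at h0
  rw [add_mul, one_mul, map_add, ← h0] at h1
  rw [← Nat.succ_eq_add_one] at h1
  rw [← sub_eq_iff_eq_add'.mpr h1, coeff_genFun, coeff_genFun, ← sum_sub_distrib]
  refine sum_congr rfl fun p _ => ?_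
  rw [Finsupp.prod_mul, Finsupp.prod_mul, toFinsupp_prod_ite_one, toFinsupp_prod_ite_one,
    toFinsupp_prod_pow]
  rcases eq_or_ne (p.parts.count 1) 0 with h | h
  · simp [h]
  · simp [h]

/-- Abel summation over `L`: partitions with all parts at most `L` have a product as generating
function, and consecutive products differ by one explicit term. -/
theorem sum_partition_largestPart (b F : ℕ → R) (n : ℕ) :
    ∑ p : n.Partition, F p.largestPart * (p.parts.map b).prod =
      coeff n (C (F 0) + ∑ L ∈ range n, C (F (L + 1) * b (L + 1)) *
        (X ^ (L + 1) * ∏ i ∈ range (L + 1), geo (b (i + 1)) i)) := by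
  have hH (L : ℕ) : ∑ p : n.Partition, (p.parts.map b).prod * (if p.largestPart ≤ L then 1 else 0) =
      coeff n (∏ i ∈ range L, geo (b (i + 1)) i) := by
    have h := sum_partition_prod (fun i => if i ≤ L then b i else 0) L n
      (fun i hi => if_neg (by omega))
    simp_rw [prod_map_ite_le] at h
    rw [prod_congr rfl fun i hi => by rw [if_pos (by simpa using hi)]] at h
    simpa using h
  have hF : ∀ p : n.Partition, F p.largestPart * (p.parts.map b).prod =
      F 0 * ((p.parts.map b).prod * (if p.largestPart ≤ 0 then 1 else 0)) +
      ∑ L ∈ range n, F (L + 1) * ((p.parts.map b).prod * (if p.largestPart ≤ L + 1 then 1 else 0) -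
        (p.parts.map b).prod * (if p.largestPart ≤ L then 1 else 0)) := by
    intro p
    conv_lhs => rw [← sum_range_mul_ite_sub F (largestPart_le p)]
    rw [add_mul, sum_mul]
    congr 1
    · ring
    · exact sum_congr rfl fun L _ => by ring
  rw [sum_congr rfl fun p _ => hF p, sum_add_distrib, sum_comm, ← mul_sum, hH, map_add, map_sum]
  congr 1
  · rw [range_zero, prod_empty, ← coeff_C_mul, mul_one]
  · refine sum_congr rfl fun L _ => ?_
    rw [← mul_sum, sum_sub_distrib, hH, hH, ← map_sub, ← coeff_C_mul]
    congr 1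
    rw [prod_range_succ, map_mul]
    linear_combination (C (F (L + 1)) * ∏ i ∈ range L, geo (b (i + 1)) i) *
      one_sub_mul_geo (b (L + 1)) L

/-- Sorting by largest part gives Fine's series, after `y ^ (L + 1) * z = y ^ L`; its Durfee square
form is then truncated at `n`. -/
theorem sum_partition_rank {y z : R} (hyz : y * z = 1) (n : ℕ) :
    ∑ p : n.Partition, y ^ p.largestPart * z ^ p.parts.card =
      coeff n (∑ k ∈ range (n + 1), X ^ (k ^ 2) * (invFac (geo y) k * invFac (geo z) k)) := by
  have h := sum_partition_largestPart (fun _ => z) (fun L => y ^ L) n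
  simp only [Multiset.map_const', Multiset.prod_replicate] at h
  rw [h]
  have h1 := one_add_fineSeries_eq_sum hyz n
  have h2 : coeff n (1 + X * (geo z 0 * fineSeries y z 0)) =
      coeff n (∑ k ∈ range (n + 1), X ^ (k ^ 2) * (invFac (geo y) k * invFac (geo z) k)) :=
    coeff_eq_of_X_pow_dvd_sub (N := (n + 1) ^ 2) ⟨_, sub_eq_iff_eq_add'.mpr h1⟩ (by nlinarith)
  rw [← h2]
  have h3 := (X_pow_dvd_tsum_sub_sum_range
    (fun k => (X_pow_dvd_C_mul_X_pow y 0 k).mul_right (∏ i ∈ range k, geo z (0 + 1 + i))) n)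
  have h4 := mul_dvd_mul_left X (h3.mul_left (geo z 0))
  rw [← pow_succ'] at h4
  refine (coeff_eq_of_X_pow_dvd_sub (N := n + 1) ?_ (Nat.lt_succ_self n)).symm
  convert h4 using 1
  rw [pow_zero, map_one, add_sub_add_left_eq_sub, mul_sub, mul_sub]
  congr 1
  rw [mul_sum, mul_sum]
  refine sum_congr rfl fun L _ => ?_
  rw [prod_range_succ', pow_succ, mul_assoc (y ^ L), hyz, mul_one]
  simp only [zero_add, add_comm 1, mul_pow, map_pow, pow_one]
  ring

/-- Part 1 gets weight 0, which yields (1-X) times Euler's series up to two terms: the empty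
partition contributes 1 instead of 1-X, and the term `L = 1` must be absent. -/
theorem sum_partition_no_ones (y : R) (n : ℕ) :
    ∑ p : n.Partition, (if p.parts.count 1 = 0 then y ^ p.largestPart else 0) =
      coeff n ((1 - X) * eulerSeries y 0 + X - C y * X) := by
  have h := sum_partition_largestPart (fun i => if i = 1 then 0 else 1) (fun L => y ^ L) n
  have hp : ∀ p : n.Partition, y ^ p.largestPart *
      (p.parts.map fun i => if i = 1 then (0 : R) else 1).prod =
      if p.parts.count 1 = 0 then y ^ p.largestPart else 0 := by
    intro p
    split_ifs with h
    · rw [Multiset.prod_eq_one, mul_one]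
      intro x hx
      obtain ⟨i, hi, rfl⟩ := Multiset.mem_map.mp hx
      rw [if_neg]
      rintro rfl
      exact Multiset.count_eq_zero.mp h hi
    · rw [Multiset.prod_eq_zero, mul_zero]
      exact Multiset.mem_map.mpr ⟨1, by simpa [Multiset.count_eq_zero] using h, if_pos rfl⟩
  rw [sum_congr rfl fun p _ => hp p] at h
  rw [h]
  have h0 : geo (0 : R) 0 = 1 := by simpa using one_sub_mul_geo (0 : R) 0
  have h1 := one_sub_mul_geo_one (R := R) 0
  rw [zero_add, pow_one] at h1
  have hne (i : ℕ) : ¬ i + 1 + 1 = 1 := by omega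
  have hI (L : ℕ) : ∏ i ∈ range (L + 1), geo (if i + 1 = 1 then (0 : R) else 1) i =
      (1 - X) * invFac (geo 1) (L + 1) := by
    rw [invFac, prod_range_succ', prod_range_succ']
    simp only [hne, if_false, if_true, zero_add, h0]
    linear_combination -(∏ i ∈ range L, geo (1 : R) (i + 1)) * h1
  simp_rw [hI]
  have h3 := (X_pow_dvd_tsum_sub_sum_range
    (fun k => (X_pow_dvd_C_mul_X_pow y 0 k).mul_right (invFac (geo 1) k)) (n + 1)).mul_left (1 - X)
  have hX : (X : R⟦X⟧) ∣ C y * X := dvd_mul_left _ _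
  -- The term `L = 1` is in the range only for `n ≥ 1`.
  cases n with
  | zero =>
    refine (coeff_eq_of_X_pow_dvd_sub (N := 1) ?_ one_pos).symm
    rw [zero_add, pow_one] at h3
    convert h3.sub hX using 1
    · rw [pow_one]
    · simp [eulerSeries]; ring
  | succ n =>
    have e : ∑ L ∈ range (n + 1), C (y ^ (L + 1) * if L + 1 = 1 then 0 else 1) *
        (X ^ (L + 1) * ((1 - X) * invFac (geo 1) (L + 1))) =
        (1 - X) * ∑ L ∈ range (n + 1 + 1), (C y * X ^ (0 + 1)) ^ L * invFac (geo 1) L -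
          (1 - X) - C y * X := by
      rw [sum_range_succ', sum_range_succ' _ (n + 1), sum_range_succ' _ n, invFac_succ _ 0]
      simp only [hne, if_false, if_true, zero_add, mul_zero, map_zero, zero_mul, add_zero, pow_zero,
        pow_one, invFac_zero, mul_one, one_mul, mul_add, mul_sum]
      rw [sum_congr rfl fun L _ => show (C (y ^ (L + 1 + 1)) : R⟦X⟧) * (X ^ (L + 1 + 1) *
        ((1 - X) * invFac (geo 1) (L + 1 + 1))) =
        (1 - X) * ((C y * X) ^ (L + 1 + 1) * invFac (geo 1) (L + 1 + 1)) by
          rw [map_pow, mul_pow]; ring]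
      linear_combination -(C y * X) * h1
    refine (coeff_eq_of_X_pow_dvd_sub (N := n + 1 + 1) ?_ (Nat.lt_succ_self _)).symm
    convert h3 using 1
    rw [e, eulerSeries, pow_zero, map_one]
    ring

/-- Parts up to `ω + 1` have weight 1 and larger ones weight `y`. The cutoff `M` makes the product
finite without excluding any partition of `n`. -/
theorem sum_partition_ones (y : R) {n M ω : ℕ} (hn : n ≤ M) (hω : ω + 1 ≤ M) :
    ∑ p : n.Partition, (if p.parts.count 1 = ω + 1 then
        y ^ (p.parts.filter fun i => ω + 1 < i).card else 0) =
      coeff n (X ^ (ω + 1) * ((1 - X) * (invFac (geo 1) (ω + 1) *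
        (∏ i ∈ range (ω + 1), (1 - C y * X ^ (0 + 1 + i))) * invFac (geo y) M))) := by
  have h := sum_partition_count_one (fun i => if i ≤ M then if i ≤ ω + 1 then 1 else y else 0)
    M n (ω + 1) (by omega) (by omega) (by simp; omega) (fun i hi => if_neg (by omega))
  have hM (p : n.Partition) : p.largestPart ≤ M := (largestPart_le p).trans hn
  simp only [prod_map_ite_le, hM, if_true, prod_map_ite_lt] at h
  rw [h]
  congr 3
  obtain ⟨k, rfl⟩ := Nat.exists_eq_add_of_le hω
  rw [invFac, invFac, prod_range_add _ (ω + 1) k, prod_range_add _ (ω + 1) k]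
  have h1 : ∏ i ∈ range (ω + 1), geo (if i + 1 ≤ ω + 1 + k then
      if i + 1 ≤ ω + 1 then 1 else y else 0) i = ∏ i ∈ range (ω + 1), geo 1 i :=
    prod_congr rfl fun i hi => by
      have := mem_range.mp hi
      rw [if_pos (by omega), if_pos (by omega)]
  have h2 : ∏ i ∈ range k, geo (if ω + 1 + i + 1 ≤ ω + 1 + k then
      if ω + 1 + i + 1 ≤ ω + 1 then 1 else y else 0) (ω + 1 + i) =
      ∏ i ∈ range k, geo y (ω + 1 + i) :=
    prod_congr rfl fun i hi => by
      have := mem_range.mp hi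
      rw [if_pos (by omega), if_neg (by omega)]
  have h3 : (∏ i ∈ range (ω + 1), (1 - C y * X ^ (0 + 1 + i))) *
      ∏ i ∈ range (ω + 1), geo y i = 1 := by
    rw [← prod_mul_distrib]
    refine prod_eq_one fun i _ => ?_
    rw [zero_add, add_comm 1 i, one_sub_mul_geo]
  rw [h1, h2]
  linear_combination -(∏ i ∈ range (ω + 1), geo 1 i) * (∏ i ∈ range k, geo y (ω + 1 + i)) * h3

/-- The partitions without ones supply the zeroth term of the q-binomial series and those with `ω`
ones its `ω`th term. The correction X - yX is felt only at `n = 1`. -/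
theorem sum_partition_crank {y z : R} (hyz : y * z = 1) {n M : ℕ} (hn : n ≤ M) :
    ∑ p : n.Partition, (if p.parts.count 1 = 0 then y ^ p.largestPart else
        y ^ (p.parts.filter fun i => p.parts.count 1 < i).card * z ^ p.parts.count 1) =
      coeff n (X - C y * X + qFac X M * (invFac (geo y) M * invFac (geo z) M)) := by
  have hp : ∀ p : n.Partition, (if p.parts.count 1 = 0 then y ^ p.largestPart else
        y ^ (p.parts.filter fun i => p.parts.count 1 < i).card * z ^ p.parts.count 1) =
      (if p.parts.count 1 = 0 then y ^ p.largestPart else 0) +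
      ∑ ω ∈ range M, z ^ (ω + 1) * (if p.parts.count 1 = ω + 1 then
        y ^ (p.parts.filter fun i => ω + 1 < i).card else 0) := by
    intro p
    have hc := count_one_le p
    generalize p.parts.count 1 = c at hc ⊢
    cases c with
    | zero => simp
    | succ c =>
      rw [sum_eq_single c]
      · simp [mul_comm]
      · intro ω _ hω
        rw [if_neg (by omega), mul_zero]
      · intro h; simp at h; omega
  rw [sum_congr rfl fun p _ => hp p, sum_add_distrib, sum_partition_no_ones, sum_comm]
  rw [sum_congr rfl fun ω hω => by
    rw [← mul_sum, sum_partition_ones y hn (mem_range.mp hω), ← coeff_C_mul], ← map_sum, ← map_add]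
  have h1 := X_pow_dvd_one_sub_mul_qBinomSeries_sub hyz M
  have h2 := (X_pow_dvd_eulerSeries_zero_sub y M).mul_left (1 - X)
  have h3 := (X_pow_dvd_tsum_sub_sum_range
    (fun k => (X_pow_dvd_C_mul_X_pow z 0 k).mul_right (invFac (geo 1) k *
      ∏ i ∈ range k, (1 - C y * X ^ (0 + 1 + i)))) (M + 1)).mul_left ((1 - X) * invFac (geo y) M)
  refine coeff_eq_of_X_pow_dvd_sub (N := M + 1) ?_ (by omega)
  convert (h2.add h1).sub h3 using 1
  have e : ∑ ω ∈ range M, C (z ^ (ω + 1)) * (X ^ (ω + 1) * ((1 - X) * (invFac (geo 1) (ω + 1) *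
        (∏ i ∈ range (ω + 1), (1 - C y * X ^ (0 + 1 + i))) * invFac (geo y) M))) =
      (1 - X) * invFac (geo y) M * ∑ ω ∈ range M, (C z * X ^ (0 + 1)) ^ (ω + 1) *
        (invFac (geo 1) (ω + 1) * ∏ i ∈ range (ω + 1), (1 - C y * X ^ (0 + 1 + i))) := by
    rw [mul_sum]
    refine sum_congr rfl fun ω _ => ?_
    rw [map_pow, mul_pow]; ring
  rw [e, sum_range_succ' _ M, qBinomSeries]
  simp only [pow_zero, invFac_zero, range_zero, prod_empty, mul_one]
  ring

end Partitions

/-! ### The second moments of rank and crank -/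

section Moments

open Finset Nat.Partition

theorem map_geo_one {R S : Type*} [CommRing R] [CommRing S] (f : R →+* S) (k : ℕ) :
    PowerSeries.map f (geo 1 k) = geo 1 k := by
  have h1 := congrArg (PowerSeries.map f) (one_sub_mul_geo_one (R := R) k)
  have h2 := one_sub_mul_geo_one (R := S) k
  simp only [map_mul, map_sub, map_one, map_pow, map_X] at h1
  linear_combination geo 1 k * h1 - PowerSeries.map f (geo 1 k) * h2

theorem map_invFac_geo_one {R S : Type*} [CommRing R] [CommRing S] (f : R →+* S) (n : ℕ) :
    PowerSeries.map f (invFac (geo 1) n) = invFac (geo 1) n := by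
  simp [invFac, map_prod, map_geo_one]

/-- The partial sum `∑_{k ≤ n} X ^ k / (1 - X ^ k) ^ 2`. -/
noncomputable def lambertSum (n : ℕ) : ℚ⟦X⟧ := ∑ k ∈ range n, X ^ (k + 1) * geo 1 k ^ 2

theorem finsum_sq_mul_card {n : ℕ} (g : n.Partition → ℤ) :
    ∑ᶠ m : ℤ, m ^ 2 * ((univ.filter fun p => g p = m).card : ℤ) = ∑ p, g p ^ 2 := by
  rw [finsum_eq_sum_of_support_subset (s := univ.image g), sum_comp (fun m => m ^ 2) g]
  · exact sum_congr rfl fun m _ => by rw [nsmul_eq_mul, mul_comm]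
  · intro m hm
    by_contra h
    apply hm
    have : univ.filter (fun p => g p = m) = ∅ := by
      ext p; simp at h ⊢; exact h p
    simp [this]

theorem rankMoment2_eq_sum (n : ℕ) : rankMoment2 n = ∑ p : n.Partition, p.rank ^ 2 :=
  finsum_sq_mul_card _

theorem crankMoment2_eq_sum {n : ℕ} (hn : n ≠ 1) :
    crankMoment2 n = ∑ p : n.Partition, p.crank ^ 2 := by
  rw [crankMoment2]
  simp_rw [crankCount, if_neg hn]
  exact finsum_sq_mul_card _

theorem crankMoment2_one : crankMoment2 1 = 2 := by
  rw [crankMoment2, finsum_eq_sum_of_support_subset (s := {1, -1})]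
  · simp [crankCount]
  · intro m hm
    by_contra h
    apply hm
    have h' : ¬ (m = 1 ∨ m = -1) := by simpa using h
    by_cases h0 : m = 0 <;> simp [crankCount, h0, h']

theorem crank_partition_one (p : Nat.Partition 1) : p.crank = -1 := by
  rw [Subsingleton.elim p (Nat.Partition.indiscrete 1)]
  simp [crank, Nat.Partition.indiscrete]

section LinearForm

variable {R : Type*} [CommRing R] [Algebra ℚ R] {y z : R} {φ : R →ₗ[ℚ] ℚ}

/-- `φ` kills 1 and takes y+z-2 to 2, by `hφ` at (0,0), (1,0) and (0,1). -/
theorem linearForm_coeff (hφ : ∀ a b : ℕ, φ (y ^ a * z ^ b) = ((a : ℚ) - b) ^ 2)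
    (a b : ℚ⟦X⟧) (n : ℕ) :
    φ (coeff n (PowerSeries.map (algebraMap ℚ R) a +
      C (y + z - 2) * PowerSeries.map (algebraMap ℚ R) b)) = 2 * coeff n b := by
  have h0 : φ 1 = 0 := by simpa using hφ 0 0
  have hy : φ y = 1 := by simpa using hφ 1 0
  have hz : φ z = 1 := by simpa using hφ 0 1
  have hw : φ (y + z - 2) = 2 := by
    rw [← one_add_one_eq_two, map_sub, map_add, map_add, h0, hy, hz]; norm_num
  rw [map_add, coeff_C_mul, coeff_map, coeff_map, map_add, Algebra.algebraMap_eq_smul_one, map_smul,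
    h0, mul_comm, ← Algebra.smul_def, map_smul, hw, smul_zero, zero_add, smul_eq_mul, mul_comm]

theorem invFac_geo_mul_invFac_geo_eq_map (hyz : y * z = 1) (hw : (y + z - 2) ^ 2 = 0) (n : ℕ) :
    invFac (geo y) n * invFac (geo z) n =
    PowerSeries.map (algebraMap ℚ R) (invFac (geo 1) n ^ 2) + C (y + z - 2) *
      PowerSeries.map (algebraMap ℚ R) (invFac (geo 1) n ^ 2 * lambertSum n) := by
  rw [invFac_geo_mul_invFac_geo hyz hw]
  simp only [lambertSum, map_mul, map_pow, map_sum, map_invFac_geo_one, map_geo_one, map_X]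
  ring

variable [TopologicalSpace R] [T2Space R] [IsTopologicalRing R]

theorem rankMoment2_eq_coeff_of_linearForm (hyz : y * z = 1) (hw : (y + z - 2) ^ 2 = 0)
    (hφ : ∀ a b : ℕ, φ (y ^ a * z ^ b) = ((a : ℚ) - b) ^ 2) (n : ℕ) : (rankMoment2 n : ℚ) =
    coeff n (2 * ∑ k ∈ range (n + 1), X ^ (k ^ 2) * (invFac (geo 1) k ^ 2 * lambertSum k)) := by
  have h := congrArg φ (sum_partition_rank hyz n)
  simp_rw [map_sum, hφ] at h
  rw [rankMoment2_eq_sum]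
  push_cast [Nat.Partition.rank]
  rw [h, show (2 : ℚ⟦X⟧) = C 2 from (map_ofNat C 2).symm, coeff_C_mul, map_sum, mul_sum]
  refine sum_congr rfl fun k _ => ?_
  rw [← linearForm_coeff hφ (X ^ (k ^ 2) * invFac (geo 1) k ^ 2),
    invFac_geo_mul_invFac_geo_eq_map hyz hw]
  congr 2
  simp only [map_mul, map_pow, map_X]
  ring

theorem crankMoment2_eq_coeff_of_linearForm (hyz : y * z = 1) (hw : (y + z - 2) ^ 2 = 0)
    (hφ : ∀ a b : ℕ, φ (y ^ a * z ^ b) = ((a : ℚ) - b) ^ 2) {n M : ℕ} (hn : n ≤ M) :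
    (crankMoment2 n : ℚ) = coeff n (2 * (invFac (geo 1) M * lambertSum M)) := by
  have h := congrArg φ (sum_partition_crank hyz hn)
  have h1 : qFac (X : R⟦X⟧) M * (invFac (geo y) M * invFac (geo z) M) =
      PowerSeries.map (algebraMap ℚ R) (invFac (geo 1) M) + C (y + z - 2) *
      PowerSeries.map (algebraMap ℚ R) (invFac (geo 1) M * lambertSum M) := by
    rw [invFac_geo_mul_invFac_geo_eq_map hyz hw]
    simp only [map_mul, map_pow, map_invFac_geo_one]
    have := qFac_mul_invFac (one_sub_mul_geo_one (R := R)) M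
    linear_combination invFac (geo 1) M * (1 + C (y + z - 2) *
      PowerSeries.map (algebraMap ℚ R) (lambertSum M)) * this
  have h2 : ∀ p : n.Partition, φ (if p.parts.count 1 = 0 then y ^ p.largestPart else
      y ^ (p.parts.filter fun i => p.parts.count 1 < i).card *
        z ^ p.parts.count 1) = (p.crank : ℚ) ^ 2 := by
    intro p
    rw [crank]
    split_ifs
    · simpa using hφ p.largestPart 0
    · rw [hφ]; push_cast; rfl
  have h0 : φ 1 = 0 := by simpa using hφ 0 0
  have hy : φ y = 1 := by simpa using hφ 1 0
  rw [h1, map_add, map_add, linearForm_coeff hφ, map_sum, sum_congr rfl fun p _ => h2 p] at h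
  rw [show (2 : ℚ⟦X⟧) = C 2 from (map_ofNat C 2).symm, coeff_C_mul, ← sub_eq_iff_eq_add'.mpr h]
  -- At `n = 1` the only partition has crank -1, so the squares sum to 1; the correction contributes
  -- φ(1-y) = -1, and the difference is the conventional value 2.
  by_cases hn1 : n = 1
  · subst hn1
    rw [crankMoment2_one]
    simp only [crank_partition_one]
    simp [h0, hy]
    norm_num
  · rw [crankMoment2_eq_sum hn1]
    simp [coeff_X, hn1]

end LinearForm

/-! ### The ring that extracts second moments -/

/-- The element `(1 + t ε) (1 + t δ)` of `ℚ[ε, δ] / (ε², δ²)`. -/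
def biExp (t : ℚ) : DualNumber (DualNumber ℚ) := ((1, t), (t, t ^ 2))

/-- The coefficient of `ε δ`, as a linear form on `ℚ[ε, δ] / (ε², δ²)`. -/
def mixedCoeff : DualNumber (DualNumber ℚ) →ₗ[ℚ] ℚ where
  toFun x := x.snd.snd
  map_add' _ _ := rfl
  map_smul' _ _ := rfl

/-- `biExp t` is exp(t(ε+δ)), because ε and δ square to zero. -/
theorem biExp_mul (s t : ℚ) : biExp s * biExp t = biExp (s + t) := by
  have e (r : ℚ) : biExp r = .inl (.inl 1 + .inr r) + .inr (.inl r + .inr (r ^ 2)) := by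
    ext <;> simp [biExp] <;> rfl
  rw [e, e, e]
  ext <;> simp <;> ring

theorem biExp_zero : biExp 0 = 1 := by
  ext <;> simp [biExp] <;> rfl

theorem biExp_pow (t : ℚ) (n : ℕ) : biExp t ^ n = biExp (n * t) := by
  induction n with
  | zero => simp [biExp_zero]
  | succ n ih => rw [pow_succ, ih, biExp_mul]; push_cast; ring_nf

theorem biExp_one_mul_biExp_neg : biExp 1 * biExp (-1) = 1 := by
  rw [biExp_mul, add_neg_cancel, biExp_zero]

theorem biExp_add_biExp_neg_sq : (biExp 1 + biExp (-1) - 2) ^ 2 = 0 := by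
  have h : biExp 1 + biExp (-1) - 2 = .inr (.inr 2) := by
    rw [← one_add_one_eq_two, ← biExp_zero, sub_eq_iff_eq_add]
    refine Prod.ext (Prod.ext ?_ ?_) (Prod.ext ?_ ?_)
    · change (1 : ℚ) + 1 = 0 + (1 + 1); norm_num
    · change (1 : ℚ) + -1 = 0 + (0 + 0); norm_num
    · change (1 : ℚ) + -1 = 0 + (0 + 0); norm_num
    · change (1 : ℚ) ^ 2 + (-1) ^ 2 = 2 + (0 ^ 2 + 0 ^ 2); norm_num
  rw [h, pow_two, TrivSqZeroExt.inr_mul_inr]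

theorem mixedCoeff_biExp_pow_mul (a b : ℕ) :
    mixedCoeff (biExp 1 ^ a * biExp (-1) ^ b) = ((a : ℚ) - b) ^ 2 := by
  rw [biExp_pow, biExp_pow, biExp_mul, mul_one, mul_neg_one, ← sub_eq_add_neg]
  rfl

theorem rankMoment2_eq_coeff (n : ℕ) : (rankMoment2 n : ℚ) =
    coeff n (2 * ∑ k ∈ range (n + 1), X ^ (k ^ 2) * (invFac (geo 1) k ^ 2 * lambertSum k)) :=
  rankMoment2_eq_coeff_of_linearForm (R := DualNumber (DualNumber ℚ)) (y := biExp 1)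
    (z := biExp (-1)) (φ := mixedCoeff) biExp_one_mul_biExp_neg biExp_add_biExp_neg_sq
    mixedCoeff_biExp_pow_mul n

theorem crankMoment2_eq_coeff {n M : ℕ} (hn : n ≤ M) : (crankMoment2 n : ℚ) =
    coeff n (2 * (invFac (geo 1) M * lambertSum M)) :=
  crankMoment2_eq_coeff_of_linearForm (R := DualNumber (DualNumber ℚ)) (y := biExp 1)
    (z := biExp (-1)) (φ := mixedCoeff) biExp_one_mul_biExp_neg biExp_add_biExp_neg_sq
    mixedCoeff_biExp_pow_mul hn

end Moments

/-! ### Infinite products -/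

section Products

open Finset

theorem X_pow_dvd_tprod_sub_one {f : ℕ → ℚ⟦X⟧} {N : ℕ} (hf : Multipliable f)
    (h : ∀ i, X ^ N ∣ f i - 1) : X ^ N ∣ ∏' i, f i - 1 := by
  rw [X_pow_dvd_iff]
  intro m hm
  have h1 := ((WithPiTopology.continuous_coeff ℚ m).tendsto _).comp hf.hasProd
  have h2 (s : Finset ℕ) : coeff m (∏ i ∈ s, f i) = coeff m (1 : ℚ⟦X⟧) :=
    coeff_eq_of_X_pow_dvd_sub (X_pow_dvd_prod_sub_one s fun i _ => h i) hm
  rw [map_sub, sub_eq_zero]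
  refine tendsto_nhds_unique h1 (tendsto_const_nhds.congr fun s => ?_)
  exact (h2 s).symm

theorem X_pow_dvd_qPochInf_sub_one (m : ℕ) {b : ℚ⟦X⟧} (hb : constantCoeff b = 0) :
    X ^ m ∣ qPochInf (X ^ m) b - 1 :=
  X_pow_dvd_tprod_sub_one (qPochInf_multipliable _ _ hb) fun i => ⟨-b ^ i, by ring⟩

theorem constantCoeff_qPochInf_X_pow {m : ℕ} (hm : m ≠ 0) {b : ℚ⟦X⟧} (hb : constantCoeff b = 0) :
    constantCoeff (qPochInf (X ^ m) b) = 1 := by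
  have h := coeff_eq_of_X_pow_dvd_sub (X_pow_dvd_qPochInf_sub_one m hb) (Nat.pos_of_ne_zero hm)
  simpa using h

theorem prod_mul_qPochInf (a : ℚ⟦X⟧) {b : ℚ⟦X⟧} (hb : constantCoeff b = 0) (n : ℕ) :
    (∏ i ∈ range n, (1 - a * b ^ i)) * qPochInf (a * b ^ n) b = qPochInf a b := by
  have e : (fun i => 1 - a * b ^ (i + n)) = fun i => 1 - a * b ^ n * b ^ i := by
    funext i; rw [pow_add]; ring
  have h : Multipliable fun i => 1 - a * b ^ (i + n) :=
    e ▸ qPochInf_multipliable (a * b ^ n) b hb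
  have h1 := Multipliable.prod_mul_tprod_nat_mul' (f := fun i => 1 - a * b ^ i) h
  rw [e] at h1
  exact h1

theorem qFac_mul_qPochInf (n : ℕ) : qFac X n * qPochInf (X ^ (n + 1)) X = qPochInf X X := by
  rw [← prod_mul_qPochInf X (by simp) n, qFac, ← pow_succ']
  congr 1
  exact prod_congr rfl fun i _ => by rw [pow_succ']

theorem prod_odd_mul_qPochInf (n : ℕ) :
    (∏ i ∈ range n, (1 - X ^ (2 * i + 1))) * qPochInf (X ^ (2 * n + 1)) (X ^ 2) =
      qPochInf X (X ^ 2) := by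
  rw [← prod_mul_qPochInf X (by simp) n, ← pow_mul, ← pow_succ']
  congr 1
  exact prod_congr rfl fun i _ => by rw [← pow_mul, ← pow_succ']

theorem qPochInf_X_X : qPochInf X X = qPochInf X (X ^ 2) * qPochInf (X ^ 2) (X ^ 2) := by
  have h1 : ∀ k : ℕ, (1 - X * X ^ (2 * k) : ℚ⟦X⟧) = 1 - X * (X ^ 2) ^ k := fun k => by ring
  have h2 : ∀ k : ℕ, (1 - X * X ^ (2 * k + 1) : ℚ⟦X⟧) = 1 - X ^ 2 * (X ^ 2) ^ k := fun k => by ring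
  have h := tprod_even_mul_odd (f := fun k => (1 - X * X ^ k : ℚ⟦X⟧))
    ((qPochInf_multipliable X (X ^ 2) (by simp)).congr fun k => (h1 k).symm)
    ((qPochInf_multipliable (X ^ 2) (X ^ 2) (by simp)).congr fun k => (h2 k).symm)
  simp_rw [h1, h2] at h
  exact h.symm

theorem inv_one_sub_X_pow (k : ℕ) : (1 - X ^ (k + 1) : ℚ⟦X⟧)⁻¹ = geo 1 k :=
  ((eq_inv_iff_mul_eq_one (by simp)).mpr (by rw [mul_comm, one_sub_mul_geo_one])).symm

theorem constantCoeff_qPochInf_X_X : constantCoeff (qPochInf (X : ℚ⟦X⟧) X) = 1 := by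
  simpa using constantCoeff_qPochInf_X_pow one_ne_zero (b := X) (by simp)

theorem X_pow_dvd_inv_qPochInf_sub (N : ℕ) :
    X ^ (N + 1) ∣ (qPochInf X X)⁻¹ - invFac (geo (1 : ℚ)) N := by
  have h1 := X_pow_dvd_qPochInf_sub_one (N + 1) (b := X) (by simp)
  have h2 := qFac_mul_qPochInf N
  have h3 := qFac_mul_invFac (one_sub_mul_geo_one (R := ℚ)) N
  have h4 := PowerSeries.mul_inv_cancel (qPochInf X X) (by simp [constantCoeff_qPochInf_X_X])
  rw [← dvd_neg]
  convert h1.mul_left ((qPochInf X X)⁻¹) using 1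
  rw [← h2] at h4 ⊢
  linear_combination -(invFac (geo 1) N) * h4 + qPochInf (X ^ (N + 1)) X *
    (qFac X N * qPochInf (X ^ (N + 1)) X)⁻¹ * h3

/-- With n = m+1, use (q^{2n+1};q²)_∞ = (q;q²)_∞/(q;q²)_n, (q^{n+1})_∞ = (q)_∞/(q)_n and 1/(1-q^n)²
= (q)_{n-1}²/(q)_n², then cancel (q;q²)_∞ against (q)_∞. -/
theorem summand_eq (e m : ℕ) :
    (X : ℚ⟦X⟧) ^ e * qPochInf (X ^ (2 * (m + 1) + 1)) (X ^ 2) *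
        ((1 - X ^ (m + 1)) ^ 2 * qPochInf (X ^ (m + 1 + 1)) X)⁻¹ =
      (qPochInf (X ^ 2) (X ^ 2))⁻¹ * (X ^ e * qFac X m ^ 2 *
        (invFac (geo 1) (m + 1) * ∏ i ∈ range (m + 1), geo 1 (2 * i))) := by
  have hc : constantCoeff ((1 - X ^ (m + 1)) ^ 2 * qPochInf (X ^ (m + 1 + 1)) X : ℚ⟦X⟧) ≠ 0 := by
    simp [constantCoeff_qPochInf_X_pow (Nat.succ_ne_zero (m + 1)) (b := X) (by simp)]
  symm
  rw [eq_mul_inv_iff_mul_eq hc]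
  have h1 := qFac_mul_qPochInf (m + 1)
  have h2 := prod_odd_mul_qPochInf (m + 1)
  have h3 := qFac_mul_invFac (one_sub_mul_geo_one (R := ℚ)) (m + 1)
  have h4 := PowerSeries.mul_inv_cancel (qPochInf (X ^ 2) (X ^ 2))
    (by simp [constantCoeff_qPochInf_X_pow two_ne_zero (b := X ^ 2) (by simp)])
  have h5 : (∏ i ∈ range (m + 1), (1 - X ^ (2 * i + 1))) *
      ∏ i ∈ range (m + 1), geo (1 : ℚ) (2 * i) = 1 := by
    rw [← prod_mul_distrib]
    exact prod_eq_one fun i _ => one_sub_mul_geo_one (2 * i)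
  have h6 := qPochInf_X_X
  rw [qFac_succ] at h1 h3
  generalize ∏ i ∈ range (m + 1), (1 - X ^ (2 * i + 1) : ℚ⟦X⟧) = o at *
  generalize ∏ i ∈ range (m + 1), geo (1 : ℚ) (2 * i) = v at *
  generalize qPochInf (X ^ (2 * (m + 1) + 1)) (X ^ 2) = A at *
  generalize qPochInf (X ^ (m + 1 + 1)) X = B at *
  generalize (qPochInf (X ^ 2) (X ^ 2))⁻¹ = W at *
  generalize qPochInf (X ^ 2) (X ^ 2) = Ev at *
  generalize qPochInf X (X ^ 2) = O at *
  generalize qPochInf (X : ℚ⟦X⟧) X = Q at *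
  generalize invFac (geo (1 : ℚ)) (m + 1) = I at *
  generalize qFac (X : ℚ⟦X⟧) m = P at *
  linear_combination X ^ e * W * P * (1 - X ^ (m + 1)) * v * B * h3 + X ^ e * W * v * h1 +
    X ^ e * W * v * h6 + X ^ e * v * O * h4 - X ^ e * v * h2 + X ^ e * A * h5

end Products

/-! ### The substitution `X ↦ X ^ 2` and Lambert series -/

section Final

open Finset

theorem continuous_expand (p : ℕ) (hp : p ≠ 0) : Continuous (expand p hp : ℚ⟦X⟧ →ₐ[ℚ] ℚ⟦X⟧) := by
  rw [continuous_iff_continuousAt]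
  intro f
  rw [ContinuousAt, WithPiTopology.tendsto_iff_coeff_tendsto]
  intro d
  simp_rw [coeff_expand]
  split_ifs
  · exact (WithPiTopology.continuous_coeff ℚ (d / p)).tendsto f
  · exact tendsto_const_nhds

theorem expand_geo_one (p : ℕ) (k : ℕ) :
    expand (p + 1) p.succ_ne_zero (geo (1 : ℚ) k) = geo 1 (p * (k + 1) + k) := by
  have h1 := congrArg (expand (p + 1) p.succ_ne_zero) (one_sub_mul_geo_one (R := ℚ) k)
  have h2 := one_sub_mul_geo_one (R := ℚ) (p * (k + 1) + k)
  simp only [map_mul, map_sub, map_one, map_pow, expand_X] at h1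
  rw [← pow_mul, show (p + 1) * (k + 1) = p * (k + 1) + k + 1 by ring] at h1
  linear_combination geo 1 (p * (k + 1) + k) * h1 - expand (p + 1) p.succ_ne_zero (geo 1 k) * h2

theorem expand_two_qPochInf :
    expand 2 two_ne_zero (qPochInf X X) = qPochInf (X ^ 2) (X ^ 2) := by
  have h := (qPochInf_multipliable X X (by simp)).hasProd.map (expand 2 two_ne_zero)
    (continuous_expand 2 two_ne_zero)
  rw [qPochInf, qPochInf, ← h.tprod_eq]
  exact tprod_congr fun k => by simp

theorem expand_two_inv_qPochInf :
    expand 2 two_ne_zero (qPochInf X X)⁻¹ = (qPochInf (X ^ 2) (X ^ 2))⁻¹ := by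
  rw [eq_inv_iff_mul_eq_one (by simp [constantCoeff_qPochInf_X_pow two_ne_zero (b := X ^ 2)]),
    ← expand_two_qPochInf, ← map_mul, PowerSeries.inv_mul_cancel _
      (by simp [constantCoeff_qPochInf_X_X]), map_one]

theorem hasSum_pnat_of_succPNat {f : ℕ+ → ℚ⟦X⟧} {g : ℕ → ℚ⟦X⟧} {a : ℚ⟦X⟧} (h : HasSum g a)
    (hfg : ∀ n : ℕ, f n.succPNat = g n) : HasSum f a := by
  rw [← Equiv.pnatEquivNat.symm.hasSum_iff]
  rwa [show f ∘ Equiv.pnatEquivNat.symm = g from funext hfg]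

theorem hasSum_pnat_expand_two {c : ℕ → ℤ} (h0 : c 0 = 0) :
    HasSum (fun n : ℕ+ => (c n : ℚ⟦X⟧) * X ^ (2 * (n : ℕ)))
      (expand 2 two_ne_zero (mk fun n => (c n : ℚ))) := by
  have h := (PowerSeries.hasSum_of_monomials_self (mk fun n => (c n : ℚ))).map
    (expand 2 two_ne_zero) (continuous_expand 2 two_ne_zero)
  have h1 := (hasSum_nat_add_iff' 1).mpr h
  simp only [Function.comp_apply, coeff_mk, expand_monomial, sum_range_one, h0, Int.cast_zero,
    map_zero, sub_zero] at h1
  refine hasSum_pnat_of_succPNat h1 fun n => ?_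
  rw [Nat.succPNat_coe, Nat.succ_eq_add_one, ← map_intCast (C (R := ℚ))]
  ext d
  rw [coeff_C_mul, coeff_X_pow, coeff_monomial, mul_ite, mul_one, mul_zero]

/-- The series `∑_{k ≥ 1} X ^ k / (1 - X ^ k) ^ 2`. -/
noncomputable def lambertSeries : ℚ⟦X⟧ := ∑' k, X ^ (k + 1) * geo 1 k ^ 2

theorem X_pow_dvd_lambertSeries_sub (N : ℕ) : X ^ N ∣ lambertSeries - lambertSum N :=
  X_pow_dvd_tsum_sub_sum_range (fun k => (pow_dvd_pow X (Nat.le_succ k)).mul_right _) N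

theorem X_mul_geo_zero : X * geo (1 : ℚ) 0 = PowerSeries.mk fun n => if n = 0 then 0 else 1 := by
  have h : (1 - X) * (PowerSeries.mk fun n => if n = 0 then (0 : ℚ) else 1) = X := by
    ext n
    rcases n with _ | _ | n <;> simp [sub_mul, coeff_succ_X_mul, coeff_X]
  have h1 := one_sub_mul_geo_one (R := ℚ) 0
  rw [zero_add, pow_one] at h1
  linear_combination -(geo 1 0) * h + (PowerSeries.mk fun n => if n = 0 then (0 : ℚ) else 1) * h1

theorem X_mul_geo_zero_sq : X * geo (1 : ℚ) 0 ^ 2 = PowerSeries.mk fun n => (n : ℚ) := by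
  have h : (1 - X) * (PowerSeries.mk fun n => (n : ℚ)) =
      PowerSeries.mk fun n => if n = 0 then (0 : ℚ) else 1 := by
    ext n
    rcases n with _ | n <;> simp [sub_mul, coeff_succ_X_mul]
  have h1 := one_sub_mul_geo_one (R := ℚ) 0
  rw [zero_add, pow_one] at h1
  rw [← X_mul_geo_zero] at h
  linear_combination -(geo 1 0) * h + (PowerSeries.mk fun n => (n : ℚ)) * h1

theorem coeff_X_pow_mul_geo (k m : ℕ) (hm : m ≠ 0) :
    coeff m (X ^ (k + 1) * geo (1 : ℚ) k) = if k + 1 ∣ m then 1 else 0 := by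
  have h := congrArg (expand (k + 1) k.succ_ne_zero) X_mul_geo_zero
  rw [map_mul, expand_X, expand_geo_one, zero_add, mul_one, add_zero] at h
  rw [h, coeff_expand]
  split_ifs with hd
  · rw [coeff_mk, if_neg (Nat.div_ne_zero_iff.mpr
      ⟨k.succ_ne_zero, Nat.le_of_dvd (Nat.pos_of_ne_zero hm) hd⟩)]
  · rfl

theorem coeff_X_pow_mul_geo_sq (k m : ℕ) :
    coeff m (X ^ (k + 1) * geo (1 : ℚ) k ^ 2) = if k + 1 ∣ m then ((m / (k + 1) : ℕ) : ℚ) else 0 := by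
  have h := congrArg (expand (k + 1) k.succ_ne_zero) X_mul_geo_zero_sq
  rw [map_mul, map_pow, expand_X, expand_geo_one, zero_add, mul_one, add_zero] at h
  rw [h, coeff_expand, coeff_mk]

theorem sum_range_ite_dvd (m : ℕ) (f : ℕ → ℚ) :
    ∑ k ∈ range m, (if k + 1 ∣ m then f (k + 1) else 0) = ∑ d ∈ m.divisors, f d := by
  rw [Nat.divisors, sum_filter, sum_Ico_eq_sum_range]
  exact sum_congr rfl fun k _ => by rw [add_comm 1 k]

theorem X_pow_dvd_lambert_summand (k : ℕ) :
    (X : ℚ⟦X⟧) ^ k ∣ ((k + 1 : ℕ) : ℚ⟦X⟧) * X ^ (k + 1) * geo 1 k :=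
  ((pow_dvd_pow X (Nat.le_succ k)).mul_left _).mul_right _

/-- The coefficient of `X ^ m` is the sum of d over the divisors of m on one side and of m/d on the
other. -/
theorem tsum_lambert : ∑' k : ℕ, ((k + 1 : ℕ) : ℚ⟦X⟧) * X ^ (k + 1) * geo 1 k = lambertSeries := by
  ext m
  rw [coeff_eq_of_X_pow_dvd_sub (X_pow_dvd_tsum_sub_sum_range X_pow_dvd_lambert_summand (m + 1))
    (Nat.lt_succ_self m), coeff_eq_of_X_pow_dvd_sub (X_pow_dvd_lambertSeries_sub (m + 1))
    (Nat.lt_succ_self m), lambertSum, map_sum, map_sum]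
  rcases eq_or_ne m 0 with rfl | hm
  · simp
  have e (k : ℕ) : coeff m (((k + 1 : ℕ) : ℚ⟦X⟧) * X ^ (k + 1) * geo 1 k) =
      if k + 1 ∣ m then ((k + 1 : ℕ) : ℚ) else 0 := by
    rw [mul_assoc, ← map_natCast (C (R := ℚ)), coeff_C_mul, coeff_X_pow_mul_geo k m hm, mul_ite,
      mul_one, mul_zero]
  have hlt : ¬ m + 1 ∣ m := fun h => by have := Nat.le_of_dvd (Nat.pos_of_ne_zero hm) h; omega
  simp_rw [e, coeff_X_pow_mul_geo_sq]
  rw [sum_range_succ, sum_range_succ, if_neg hlt, if_neg hlt,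
    sum_range_ite_dvd m (fun d => (d : ℚ)), sum_range_ite_dvd m (fun d => ((m / d : ℕ) : ℚ)),
    Nat.sum_div_divisors m (fun d => (d : ℚ))]

theorem hasSum_pnat_lambert : HasSum (fun n : ℕ+ =>
    ((n : ℕ) : ℚ⟦X⟧) * (X : ℚ⟦X⟧) ^ (n : ℕ) * (1 - X ^ (n : ℕ))⁻¹) lambertSeries := by
  rw [← tsum_lambert]
  refine hasSum_pnat_of_succPNat (summable_of_X_pow_dvd X_pow_dvd_lambert_summand).hasSum fun n => ?_
  rw [Nat.succPNat_coe, Nat.succ_eq_add_one, inv_one_sub_X_pow]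

/-- The coefficients of the Bailey pair with `β n = (∑_{k ≤ n} X ^ k / (1 - X ^ k) ^ 2) / (X; X)_n ^ 2`. -/
noncomputable def lambertAlpha : ℕ → ℚ⟦X⟧
  | 0 => 0
  | r + 1 => -(unitAlpha X (r + 1) * (X ^ (r + 1) * geo 1 r ^ 2))

/-- For the unit pair the left side of `IsBaileyPair.sum_range_qFac_sq` is zero, so `lambertSum n`
equals minus the weighted sum of the unit α; dividing by (X;X)_n² leaves a Bailey relation. -/
theorem isBaileyPair_lambertAlpha :
    IsBaileyPair (geo 1) lambertAlpha fun n => invFac (geo 1) n ^ 2 * lambertSum n := by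
  intro n
  have h := (isBaileyPair_unit (one_sub_mul_geo_one (R := ℚ))).sum_range_qFac_sq
    one_sub_mul_geo_one n
  simp only [Nat.add_eq_zero_iff, one_ne_zero, and_false, if_false, mul_zero, sum_const_zero,
    unitAlpha.eq_1, one_mul] at h
  change _ = lambertSum n + _ at h
  have h1 : qFac X n ^ 2 * invFac (geo (1 : ℚ)) n ^ 2 = 1 := by
    rw [← mul_pow, qFac_mul_invFac one_sub_mul_geo_one, one_pow]
  rw [sum_range_succ', lambertAlpha.eq_1, zero_mul, add_zero]
  have e : ∑ r ∈ range n, lambertAlpha (r + 1) *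
      (invFacSub (geo 1) n (r + 1) * invFac (geo 1) (n + (r + 1))) = -(invFac (geo 1) n ^ 2 *
      ∑ r ∈ range n, unitAlpha X (r + 1) * (X ^ (r + 1) * geo 1 r ^ 2 *
        (qFac X n ^ 2 * (invFacSub (geo 1) n (r + 1) * invFac (geo 1) (n + (r + 1)))))) := by
    rw [mul_sum, ← sum_neg_distrib]
    refine sum_congr rfl fun r _ => ?_
    rw [lambertAlpha.eq_2]
    linear_combination (unitAlpha X (r + 1) * (X ^ (r + 1) * geo 1 r ^ 2) *
      (invFacSub (geo 1) n (r + 1) * invFac (geo 1) (n + (r + 1)))) * h1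
  rw [e]
  linear_combination -(invFac (geo 1) n ^ 2) * h

theorem mk_rankMoment2 : (PowerSeries.mk fun n => (rankMoment2 n : ℚ)) =
    2 * ((qPochInf X X)⁻¹ * ∑' r, X ^ (r ^ 2) * lambertAlpha r) := by
  rw [← isBaileyPair_lambertAlpha.tsum_X_pow_sq X_pow_dvd_inv_qPochInf_sub]
  ext n
  rw [coeff_mk, rankMoment2_eq_coeff]
  have h := X_pow_dvd_tsum_sub_sum_range (f := fun k => X ^ (k ^ 2) *
    (invFac (geo (1 : ℚ)) k ^ 2 * lambertSum k)) (fun k => (pow_dvd_pow X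
      (show k ≤ k ^ 2 by nlinarith)).mul_right _) (n + 1)
  refine (coeff_eq_of_X_pow_dvd_sub (N := n + 1) ?_ (Nat.lt_succ_self n)).symm
  rw [← mul_sub]
  exact h.mul_left 2

theorem mk_crankMoment2 : (PowerSeries.mk fun n => (crankMoment2 n : ℚ)) =
    2 * ((qPochInf X X)⁻¹ * lambertSeries) := by
  ext n
  rw [coeff_mk, crankMoment2_eq_coeff (Nat.le_succ n)]
  refine (coeff_eq_of_X_pow_dvd_sub (N := n + 1) ?_ (Nat.lt_succ_self n)).symm
  have h1 := X_pow_dvd_lambertSeries_sub (n + 1)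
  have h2 := (pow_dvd_pow X (Nat.le_succ (n + 1))).trans (X_pow_dvd_inv_qPochInf_sub (n + 1))
  convert ((h1.mul_left (qPochInf X X)⁻¹).add (h2.mul_left (lambertSum (n + 1)))).mul_left 2 using 1
  ring

/-- The unit β vanishes at every positive index, so the left side of `IsBaileyPair.tsum_qFac_sq` is
zero. -/
theorem lambertSeries_eq :
    lambertSeries = -∑' r, unitAlpha X (r + 1) * (X ^ (r + 1) * geo 1 r ^ 2) := by
  have h := (isBaileyPair_unit (one_sub_mul_geo_one (R := ℚ))).tsum_qFac_sq
  simp only [Nat.add_eq_zero_iff, one_ne_zero, and_false, if_false, mul_zero, tsum_zero,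
    unitAlpha.eq_1, one_mul] at h
  rw [lambertSeries]
  linear_combination -h

theorem X_pow_dvd_bailey_summand (α : ℕ → ℚ⟦X⟧) (r : ℕ) :
    X ^ r ∣ α (r + 1) * (X ^ (r + 1) * geo 1 r ^ 2) :=
  ((pow_dvd_pow X (Nat.le_succ r)).mul_right _).mul_left _

theorem tsum_evenSeq (a : ℕ → ℚ⟦X⟧) :
    ∑' r, evenSeq a (r + 1) * (X ^ (r + 1) * geo 1 r ^ 2) =
      ∑' s, a (s + 1) * (X ^ (2 * s + 2) * geo 1 (2 * s + 1) ^ 2) := by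
  have h (s : ℕ) : evenSeq a (2 * s + 1 + 1) = a (s + 1) := evenSeq_two_mul a (s + 1)
  have := tsum_even_add_odd (f := fun r => evenSeq a (r + 1) * (X ^ (r + 1) * geo (1 : ℚ) r ^ 2))
    (by simp) (summable_of_X_pow_dvd fun s =>
      (pow_dvd_pow X (by omega)).trans (X_pow_dvd_bailey_summand (evenSeq a) (2 * s + 1)))
  rw [← this]
  simp only [evenSeq_two_mul_add_one, zero_mul, tsum_zero, zero_add, h]

/-- Doubling turns the triangular exponent r(r+1)/2 into r(r+1): the even-supported crank pair is
the unit pair at X². -/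
theorem expand_two_unitAlpha (r : ℕ) : expand 2 two_ne_zero (unitAlpha (X : ℚ⟦X⟧) (r + 1) *
    (X ^ (r + 1) * geo 1 r ^ 2)) =
      crankAlpha X (r + 1) * (X ^ (2 * r + 2) * geo 1 (2 * r + 1) ^ 2) := by
  have h : geo (1 : ℚ) (1 * (r + 1) + r) = geo 1 (2 * r + 1) := by congr 1; ring
  have h2 : 2 * ((r + 1) * r / 2) = (r + 1) * r :=
    Nat.mul_div_cancel' (by rw [mul_comm]; exact (Nat.even_mul_succ_self r).two_dvd)
  simp only [unitAlpha, crankAlpha, map_mul, map_add, map_pow, map_neg, map_one, expand_X]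
  rw [expand_geo_one 1 r, h, ← pow_mul, h2]
  ring

theorem expand_two_lambertSeries : expand 2 two_ne_zero lambertSeries =
    -∑' s, crankAlpha X (s + 1) * (X ^ (2 * s + 2) * geo 1 (2 * s + 1) ^ 2) := by
  rw [lambertSeries_eq, map_neg, (summable_of_X_pow_dvd (X_pow_dvd_bailey_summand _)).map_tsum _
    (continuous_expand 2 two_ne_zero)]
  simp_rw [expand_two_unitAlpha]

theorem expand_two_tsum_lambertAlpha : expand 2 two_ne_zero (∑' r, X ^ (r ^ 2) * lambertAlpha r) =
    -∑' s, rankAlpha X (s + 1) * (X ^ (2 * s + 2) * geo 1 (2 * s + 1) ^ 2) := by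
  have hs : Summable fun r => X ^ (r ^ 2) * lambertAlpha r :=
    summable_of_X_pow_dvd fun r => (pow_dvd_pow X (show r ≤ r ^ 2 by nlinarith)).mul_right _
  rw [hs.tsum_eq_zero_add, lambertAlpha.eq_1, mul_zero, zero_add,
    ((summable_nat_add_iff 1).mpr hs).map_tsum _ (continuous_expand 2 two_ne_zero), ← tsum_neg]
  refine tsum_congr fun s => ?_
  -- The additional factor X^{2(s+1)²} accounts for (s+1)(3s+2) - (s+1)s, the gap between the
  -- exponents of `rankAlpha` and `crankAlpha`.
  rw [lambertAlpha.eq_2, map_mul, map_neg, expand_two_unitAlpha, crankAlpha, rankAlpha, map_pow,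
    expand_X]
  ring

theorem rankMoment2_zero : rankMoment2 0 = 0 := by
  rw [rankMoment2_eq_sum]
  simp [Nat.Partition.rank, Nat.Partition.largestPart]

theorem crankMoment2_zero : crankMoment2 0 = 0 := by
  rw [crankMoment2_eq_sum zero_ne_one]
  simp [Nat.Partition.crank, Nat.Partition.largestPart]

theorem C_half_mul_two_mul (f : ℚ⟦X⟧) : C (1 / 2 : ℚ) * (2 * f) = f := by
  rw [show (2 : ℚ⟦X⟧) = C 2 from (map_ofNat C 2).symm, ← mul_assoc, ← map_mul]
  norm_num

theorem hasSum_summand {e : ℕ → ℕ} {α β : ℕ → ℚ⟦X⟧} (h : IsBaileyPair (geo 1) α β) (h0 : α 0 = 1)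
    (he : ∀ m, X ^ e (m + 1) * (invFac (geo 1) (m + 1) * ∏ i ∈ range (m + 1), geo (1 : ℚ) (2 * i)) =
      X ^ (m + 1) * β (m + 1)) :
    HasSum (fun n : ℕ+ => (X : ℚ⟦X⟧) ^ e n * qPochInf (X ^ (2 * (n : ℕ) + 1)) (X ^ 2) *
        ((1 - X ^ (n : ℕ)) ^ 2 * qPochInf (X ^ ((n : ℕ) + 1)) X)⁻¹)
      ((qPochInf (X ^ 2) (X ^ 2))⁻¹ * (lambertSeries +
        ∑' r, α (r + 1) * (X ^ (r + 1) * geo 1 r ^ 2))) := by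
  have h1 := h.tsum_qFac_sq
  rw [h0, one_mul] at h1
  rw [lambertSeries, ← h1]
  have hs : Summable fun n => X ^ (n + 1) * qFac X n ^ 2 * β (n + 1) :=
    summable_of_X_pow_dvd fun n => ((pow_dvd_pow X (Nat.le_succ n)).mul_right _).mul_right _
  refine hasSum_pnat_of_succPNat (hs.hasSum.mul_left (qPochInf (X ^ 2) (X ^ 2))⁻¹) fun m => ?_
  rw [Nat.succPNat_coe, Nat.succ_eq_add_one, summand_eq]
  linear_combination (qPochInf (X ^ 2) (X ^ 2))⁻¹ * qFac X m ^ 2 * he m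

end Final

theorem theorem1 :
    -- the series on the right-hand sides converge in `ℚ⟦X⟧`
    Summable (fun n : ℕ+ =>
      ((n : ℕ) : ℚ⟦X⟧) * (X : ℚ⟦X⟧) ^ (n : ℕ) * (1 - X ^ (n : ℕ))⁻¹) ∧
    Summable (fun n : ℕ+ => (rankMoment2 n : ℚ⟦X⟧) * X ^ (2 * (n : ℕ))) ∧
    Summable (fun n : ℕ+ => (crankMoment2 n : ℚ⟦X⟧) * X ^ (2 * (n : ℕ))) ∧
    -- the identity with the rank moment
    HasSum
      (fun n : ℕ+ => (X : ℚ⟦X⟧) ^ (n : ℕ) * qPochInf (X ^ (2 * (n : ℕ) + 1)) (X ^ 2) *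
        ((1 - X ^ (n : ℕ)) ^ 2 * qPochInf (X ^ ((n : ℕ) + 1)) X)⁻¹)
      ((qPochInf (X ^ 2) (X ^ 2))⁻¹ *
          (∑' n : ℕ+, ((n : ℕ) : ℚ⟦X⟧) * (X : ℚ⟦X⟧) ^ (n : ℕ) * (1 - X ^ (n : ℕ))⁻¹) -
        C (1 / 2 : ℚ) * ∑' n : ℕ+, (rankMoment2 n : ℚ⟦X⟧) * X ^ (2 * (n : ℕ))) ∧
    -- the identity with the crank moment
    HasSum
      (fun n : ℕ+ => (X : ℚ⟦X⟧) ^ ((n : ℕ) * ((n : ℕ) + 1) / 2) *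
        qPochInf (X ^ (2 * (n : ℕ) + 1)) (X ^ 2) *
        ((1 - X ^ (n : ℕ)) ^ 2 * qPochInf (X ^ ((n : ℕ) + 1)) X)⁻¹)
      ((qPochInf (X ^ 2) (X ^ 2))⁻¹ *
          (∑' n : ℕ+, ((n : ℕ) : ℚ⟦X⟧) * (X : ℚ⟦X⟧) ^ (n : ℕ) * (1 - X ^ (n : ℕ))⁻¹) -
        C (1 / 2 : ℚ) * ∑' n : ℕ+, (crankMoment2 n : ℚ⟦X⟧) * X ^ (2 * (n : ℕ))) := by
  have hN := hasSum_pnat_expand_two rankMoment2_zero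
  have hM := hasSum_pnat_expand_two crankMoment2_zero
  refine ⟨hasSum_pnat_lambert.summable, hN.summable, hM.summable, ?_, ?_⟩
  · have h := hasSum_summand (e := fun n => n) (isBaileyPair_rankAlpha (one_sub_mul_geo_one (R := ℚ)))
      rfl (fun m => rfl)
    rw [tsum_evenSeq] at h
    rw [hasSum_pnat_lambert.tsum_eq, hN.tsum_eq, mk_rankMoment2, map_mul, map_ofNat,
      C_half_mul_two_mul, map_mul, expand_two_inv_qPochInf, expand_two_tsum_lambertAlpha, mul_neg,
      sub_neg_eq_add, ← mul_add]
    exact h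
  · have h := hasSum_summand (e := fun n => n * (n + 1) / 2)
      (isBaileyPair_crankAlpha (one_sub_mul_geo_one (R := ℚ))) rfl (fun m => by
        -- n(n+1)/2 = n + n(n-1)/2 at n = m+1: the first part is the weight in the Bailey lemma, the
        -- second belongs to β.
        rw [← mul_assoc _ (X ^ _), ← pow_add, mul_comm (m + 1) (m + 1 + 1), tri_succ, add_comm (m + 1),
          Nat.add_sub_cancel])
    rw [tsum_evenSeq] at h
    rw [hasSum_pnat_lambert.tsum_eq, hM.tsum_eq, mk_crankMoment2, map_mul, map_ofNat,
      C_half_mul_two_mul, map_mul, expand_two_inv_qPochInf, expand_two_lambertSeries, mul_neg,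
      sub_neg_eq_add, ← mul_add]
    exact h
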